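/- Let $(d_k)_{k\ge 1}$ be a sequence of real numbers such that $0<d_1<1$ and, for all $k\ge 1$, $d_{k+1}\le d_k$ and $k\,d_k\le (k+1)\,d_{k+1}$. Put $f(t)=1+\sum_{k\ge1}d_kt^k$, define $(a_k)_{k\ge1}$ by $\ln f(t)=\sum_{k\ge1}a_kt^k$, and define $(h_k)_{k\ge1}$ by $$f(t)(1-t)^{h_1}(1-t^2)^{h_2}\cdots(1-t^k)^{h_k}=1+h_{k+1}t^{k+1}+\cdots\qquad(k\ge 0).$$ For integers $l,N\ge0$ put $$A_l(N)=\sum (-1)^{k_1+\cdots+k_{l+1}}\binom{-h_1}{k_1}\cdots\binom{-h_{l+1}}{k_{l+1}},$$ the sum being over all nonnegative integers $k_1,\dots,k_{l+1}$ with $k_1+2k_2+\cdots+(l+1)k_{l+1}=N$ and $k_2+2k_3+\cdots+l\,k_{l+1}=l$. Let $p(l)$ be the number of partitions of $l$. For a finite field $\mathbb F_q$ with $q$ elements let $\pi_q(l)$ be the number of monic irreducible polynomials of degree $l$ over $\mathbb F_q$, and for a multiplicative function $g:\mathbb F_q[T]\to\mathbb R$ with $g(P^k)=d_k$ for all monic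 irreducible $P$ and all $k\ge1$ let $T(N)=\sum g(F)$, where $F$ runs over the monic polynomials of degree $N$. Then the following hold. 1. $0<a_k<1/k$ for all $k\ge1$. 2. Let $N\ge190$ and $h$ be integers with $1\le h\le \frac{N}{36\ln N}$, and let $q\ge(17h)^{12h+9}$. Then $$\Bigl|T(N)-\sum_{l=0}^{h-1}A_l(N)q^{N-l}\Bigr|\le 3.1\,d_1\,p(h)\,\frac{q^{N-h}}{N^{1-d_1}},\qquad |A_l(N)|\le\frac{3d_1p(l)}{N^{1-d_1}}\quad(0\le l\le h-1).$$ 3. The infinite product $$a(x)=\prod_{l=1}^{\infty}\bigl\{f(x^l)(1-x^l)^{d_1}\bigr\}^{\pi_q(l)}$$ converges, to a nonzero value, for every complex $x$ with $|x|<q^{-1/2}$, and $a$ is holomorphic in this disc. For every integer $n\ge0$ there is a constant $C_n$, depending on $n$ only, such that for all $N\ge n+1$ $$T(N)=(-1)^N\binom{-d_1}{N}q^N\left(a(q^{-1})+\sum_{k=1}^n\frac{\binom{k-d_1}{k}}{\binom{N+d_1-1}{k}}\,\frac{q^{-k}}{k!}\,a^{(k)}(q^{-1})\right)+R_n,\qquad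 |R_n|\le C_n\,\frac{q^N}{N^{1-d_1}}\left(\frac{1}{\sqrt q\,N}\right)^{n+1}.$$ -/

import Mathlib

open scoped Polynomial PowerSeries

noncomputable section

namespace FqMean

/-- The formal power series `f(t) = 1 + d₁ t + d₂ t² + ⋯`. The value `d 0` is not used. -/
def genSeries (d : ℕ → ℝ) : ℝ⟦X⟧ :=
  PowerSeries.mk fun k => if k = 0 then 1 else d k

/-- The numbers `a₁, a₂, …` given by `log f(t) = ∑_{k ≥ 1} a_k t^k`. -/
def aSeq (d : ℕ → ℝ) (k : ℕ) : ℝ :=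
  PowerSeries.coeff k (PowerSeries.logOf (genSeries d))

/-- The binomial power series `(1 - t^i)^r`, for `i ≥ 1` and real `r`. -/
def oneSubPow (i : ℕ) (r : ℝ) : ℝ⟦X⟧ :=
  (PowerSeries.binomialSeries ℝ r).subst (-(PowerSeries.X : ℝ⟦X⟧) ^ i)

/-- The numbers `h₁, h₂, …` given by
`f(t) (1 - t)^{h₁} (1 - t²)^{h₂} ⋯ (1 - t^k)^{h_k} = 1 + h_{k+1} t^{k+1} + ⋯` for all `k ≥ 0`.
The value at `0` is not used. -/
def hSeq (d : ℕ → ℝ) : ℕ → ℝ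
  | 0 => 0
  | k + 1 => PowerSeries.coeff (k + 1)
      (genSeries d * ∏ i : Fin k, oneSubPow (i + 1) (hSeq d (i + 1)))
  termination_by k => k
  decreasing_by exact Nat.succ_lt_succ i.2

theorem coeff_oneSubPow (n : ℕ) (r : ℝ) (j : ℕ) (hj : j ≤ n + 1) :
    PowerSeries.coeff j (oneSubPow (n + 1) r) =
      if j = 0 then 1 else if j = n + 1 then -r else 0 := by
  have hs : PowerSeries.HasSubst (-(PowerSeries.X : ℝ⟦X⟧) ^ (n + 1)) :=
    PowerSeries.HasSubst.of_constantCoeff_zero' (by simp)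
  have hc : ∀ m : ℕ, PowerSeries.coeff j ((-(PowerSeries.X : ℝ⟦X⟧) ^ (n + 1)) ^ m) =
      if j = (n + 1) * m then (-1) ^ m else 0 := by
    intro m
    rw [neg_pow, ← pow_mul, show ((-1 : ℝ⟦X⟧)) ^ m = PowerSeries.C ((-1 : ℝ) ^ m) by simp,
      PowerSeries.coeff_C_mul, PowerSeries.coeff_X_pow]
    split_ifs <;> simp
  rw [oneSubPow, PowerSeries.coeff_subst' hs]
  simp only [PowerSeries.binomialSeries_coeff, hc]
  rcases Nat.eq_zero_or_pos j with h0 | h0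
  · subst h0
    rw [finsum_eq_single _ 0]
    · simp
    · intro m hm
      simp [hm]
  · rcases Nat.lt_or_eq_of_le hj with h1 | h1
    · rw [if_neg h0.ne', if_neg h1.ne, finsum_eq_zero_of_forall_eq_zero]
      intro m
      rw [if_neg, smul_zero]
      rintro rfl
      rcases Nat.eq_zero_or_pos m with hm | hm
      · simp [hm] at h0
      · nlinarith
    · subst h1
      rw [finsum_eq_single _ 1]
      · simp
      · intro m hm
        rw [if_neg, smul_zero]
        intro h
        exact hm (Nat.eq_of_mul_eq_mul_left h0 (by omega))

/-- The defining expansion of the sequence `h`. -/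
theorem hSeq_spec (d : ℕ → ℝ) (k j : ℕ) (hj : j ≤ k + 1) :
    PowerSeries.coeff j
      (genSeries d * ∏ i ∈ Finset.range k, oneSubPow (i + 1) (hSeq d (i + 1))) =
      if j = 0 then 1 else if j = k + 1 then hSeq d (k + 1) else 0 := by
  have top : ∀ k : ℕ, PowerSeries.coeff (k + 1)
      (genSeries d * ∏ i ∈ Finset.range k, oneSubPow (i + 1) (hSeq d (i + 1))) =
        hSeq d (k + 1) := by
    intro k
    rw [hSeq, Finset.prod_range fun i => oneSubPow (i + 1) (hSeq d (i + 1))]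
  induction k generalizing j with
  | zero =>
    rcases (by omega : j = 0 ∨ j = 1) with rfl | rfl
    · simp [genSeries]
    · simpa using top 0
  | succ k ih =>
    rcases Nat.lt_or_eq_of_le hj with h1 | h1
    · rw [Finset.prod_range_succ, ← mul_assoc, PowerSeries.coeff_mul]
      have hterm : ∀ p ∈ Finset.HasAntidiagonal.antidiagonal j,
          PowerSeries.coeff p.1
            (genSeries d * ∏ i ∈ Finset.range k, oneSubPow (i + 1) (hSeq d (i + 1))) *
          PowerSeries.coeff p.2 (oneSubPow (k + 1) (hSeq d (k + 1))) =
          (if p.1 = 0 then 1 else if p.1 = k + 1 then hSeq d (k + 1) else 0) *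
          (if p.2 = 0 then 1 else if p.2 = k + 1 then -hSeq d (k + 1) else 0) := by
        intro p hp
        rw [Finset.HasAntidiagonal.mem_antidiagonal] at hp
        rw [ih p.1 (by omega), coeff_oneSubPow k _ p.2 (by omega)]
      rw [Finset.sum_congr rfl hterm, if_neg h1.ne]
      rcases Nat.eq_zero_or_pos j with h0 | h0
      · subst h0
        simp
      · rw [if_neg h0.ne']
        have hne : ((0 : ℕ), j) ≠ (j, 0) := by
          intro h
          rw [Prod.mk.injEq] at h
          omega
        rw [Finset.sum_eq_add (0, j) (j, 0) hne]
        · simp only [if_true, if_neg h0.ne']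
          split_ifs <;> ring
        · rintro ⟨x, y⟩ hp ⟨hx, hy⟩
          rw [Finset.HasAntidiagonal.mem_antidiagonal] at hp
          change x + y = j at hp
          have hx0 : x ≠ 0 := by
            rintro rfl
            exact hx (by rw [← hp, zero_add])
          have hy0 : y ≠ 0 := by
            rintro rfl
            exact hy (by rw [← hp, add_zero])
          simp only [if_neg hx0, if_neg hy0, if_neg (show x ≠ k + 1 by omega), zero_mul]
        · intro h
          exact absurd (by simp) h
        · intro h
          exact absurd (by simp) h
    · subst h1
      rw [top, if_neg (by omega), if_pos rfl]

/-- `A_l(N)`, the sum over all `(k₁, …, k_{l+1})` of nonnegative integers with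
`k₁ + 2 k₂ + ⋯ + (l+1) k_{l+1} = N` and `k₂ + 2 k₃ + ⋯ + l k_{l+1} = l` of
`(-1)^{k₁ + ⋯ + k_{l+1}} binom(-h₁, k₁) ⋯ binom(-h_{l+1}, k_{l+1})`.
Here `k i` stands for `k_{i+1}`; the first equation forces every `k i ≤ N`. -/
def A (d : ℕ → ℝ) (l N : ℕ) : ℝ :=
  ∑ k ∈ (Fintype.piFinset fun _ : Fin (l + 1) => Finset.range (N + 1)).filter
      (fun k => ∑ i : Fin (l + 1), ((i : ℕ) + 1) * k i = N ∧ ∑ i : Fin (l + 1), (i : ℕ) * k i = l),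
    (∏ i : Fin (l + 1), Ring.choose (-hSeq d (i + 1)) (k i)) * (-1) ^ (∑ i, k i)

/-- A real function on `F[T]` that is multiplicative on monic polynomials. -/
def IsMultiplicative {F : Type*} [Field F] (g : F[X] → ℝ) : Prop :=
  g 1 = 1 ∧ ∀ P Q : F[X], P.Monic → Q.Monic → IsCoprime P Q → g (P * Q) = g P * g Q

theorem finite_monic (F : Type*) [Field F] [Finite F] (N : ℕ) :
    {P : F[X] | P.Monic ∧ P.natDegree = N}.Finite := by
  refine Set.Finite.of_injOn (f := fun (P : F[X]) (i : Fin (N + 1)) => P.coeff i)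
    (t := Set.univ) (fun _ _ => Set.mem_univ _) ?_ Set.finite_univ
  intro P hP Q hQ h
  ext n
  by_cases hn : n < N + 1
  · exact congrFun h ⟨n, hn⟩
  · rw [Polynomial.coeff_eq_zero_of_natDegree_lt (by rw [hP.2]; omega),
      Polynomial.coeff_eq_zero_of_natDegree_lt (by rw [hQ.2]; omega)]

/-- `T(N)`, the sum of `g` over the monic polynomials of degree `N`. -/
def T {F : Type*} [Field F] [Finite F] (g : F[X] → ℝ) (N : ℕ) : ℝ :=
  ∑ P ∈ (finite_monic F N).toFinset, g P

/-- `π_q(l)`, the number of monic irreducible polynomials of degree `l` over `F`. -/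
def primeCount (F : Type*) [Field F] (l : ℕ) : ℕ :=
  Set.ncard {P : F[X] | P.Monic ∧ Irreducible P ∧ P.natDegree = l}

/-- The sum of the power series `f` at a complex number. -/
def genFun (d : ℕ → ℝ) (x : ℂ) : ℂ :=
  ∑' k : ℕ, ((PowerSeries.coeff k (genSeries d) : ℝ) : ℂ) * x ^ k

/-- The factor `{f(x^l) (1 - x^l)^{d₁}}^{π_q(l)}`, with the principal branch of the power. -/
def eulerFactor (F : Type*) [Field F] (d : ℕ → ℝ) (l : ℕ) (x : ℂ) : ℂ :=
  (genFun d (x ^ l) * (1 - x ^ l) ^ (d 1 : ℂ)) ^ primeCount F l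

/-- The function `a(x) = ∏_{l ≥ 1} {f(x^l) (1 - x^l)^{d₁}}^{π_q(l)}`. -/
def aFun (F : Type*) [Field F] (d : ℕ → ℝ) (x : ℂ) : ℂ :=
  ∏' l : ℕ, eulerFactor F d (l + 1) x

end FqMean

end

noncomputable section

namespace FqMean

/-! ### Logarithmic derivatives of formal power series -/

section
open PowerSeries Finset

/-! Everything rests on logarithmic derivatives with respect to `theta` = t d/dt. Put b_k = k a_k,
so that `theta` f = (∑ b_k t^k) f. Subtracting consecutive coefficient relations gives a recurrence
for b_k whose weights are differences of consecutive coefficients of f. These are nonnegative, and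
the two monotonicity conditions on d trap b_k in (0, 1) (`bSeq_pos_and_lt`).

Writing deg Q as the sum of deg P · v_P(Q) gives the logarithmic derivative of ∑ T(N) t^N
(`theta_mk_T`). The case g = 1 is Gauss's count of irreducibles. Combined with ∑_{i ∣ k} i h_i = b_k
it yields the formal identity ∑ T(N) t^N = ∏_{i ≥ 1} (1 - q t^i)^{-h_i}, and collecting the
coefficient of t^N by powers of q is `T_eq_sum_A`. Möbius inversion gives |h_i| ≤ 1, so every
binomial coefficient in A_l(N) is at most 1 in absolute value. There are at most p(l) tuples, and
k_1 ≥ N - 2l makes binom(-d_1, k_1) of size N^{d_1 - 1}. For large l the crude bound `abs_A_le_pow`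
suffices, because q is large compared with 8^h.

For the asymptotic expansion the factor i = 1 is split off: a = (1 - qt)^{d_1} ∑ T(N) t^N is the
product over i ≥ 2. Its logarithmic derivative has coefficients O(q^{j/2}), so its own coefficients
are O(q^{k/2}) up to a power of k, uniformly in d and q (`exists_abs_coeff_aSeries_le`). With w =
qt, T(N) is q^N times the coefficient of w^N in (1 - w)^{-d_1} a(w/q). Each monomial w^k of a(w/q)
is expanded about w = 1 to order n. The Taylor polynomials give the main terms, and the remainders
carry (1 - w)^{n+1-d_1}, whose coefficients decay like M^{-(n+2-d_1)}. The remainder of w^k vanishes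
for k ≤ n, and the surviving k ≥ n + 1 supply the factor q^{-(n+1)/2}. -/

theorem choose_succ_mul (r : ℝ) (m : ℕ) :
    Ring.choose r (m + 1) * ((m : ℝ) + 1) = Ring.choose r m * (r - m) := by
  have h1 := Ring.descPochhammer_eq_factorial_smul_choose r (m + 1)
  have h2 := Ring.descPochhammer_eq_factorial_smul_choose r m
  rw [descPochhammer_succ_right, mul_comm, Polynomial.smeval_mul, h2, Polynomial.smeval_sub,
    Polynomial.smeval_X, Polynomial.smeval_natCast] at h1
  simp only [nsmul_eq_mul, pow_one, pow_zero, mul_one, Nat.factorial_succ] at h1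
  push_cast at h1
  have : (m.factorial : ℝ) ≠ 0 := by positivity
  apply mul_left_cancel₀ this
  linarith

theorem subst_one_eq {u : ℝ⟦X⟧} (hs : HasSubst u) : subst u (1 : ℝ⟦X⟧) = (1 : ℝ⟦X⟧) := by
  rw [← coe_substAlgHom hs, map_one]

theorem subst_C_eq {u : ℝ⟦X⟧} (hs : HasSubst u) (r : ℝ) : subst u (C r : ℝ⟦X⟧) = (C r : ℝ⟦X⟧) := by
  rw [← coe_substAlgHom hs]
  exact (substAlgHom hs).commutes r

/-- The operator `t d/dt` on power series. -/
def theta (f : ℝ⟦X⟧) : ℝ⟦X⟧ := X * d⁄dX ℝ f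

theorem coeff_theta (f : ℝ⟦X⟧) (n : ℕ) : coeff n (theta f) = n * coeff n f := by
  cases n with
  | zero => simp [theta]
  | succ n =>
    rw [theta, coeff_succ_X_mul, coeff_derivative]
    push_cast
    ring

theorem theta_mul (f g : ℝ⟦X⟧) : theta (f * g) = theta f * g + f * theta g := by
  simp only [theta, Derivation.leibniz, smul_eq_mul]
  ring

theorem theta_one : theta 1 = 0 := by
  ext n
  rw [coeff_theta, coeff_one]
  split_ifs <;> simp_all

theorem theta_prod {ι : Type*} (s : Finset ι) (f σ : ι → ℝ⟦X⟧)
    (h : ∀ i ∈ s, theta (f i) = σ i * f i) :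
    theta (∏ i ∈ s, f i) = (∑ i ∈ s, σ i) * ∏ i ∈ s, f i := by
  classical
  induction s using Finset.induction_on with
  | empty => simp [theta_one]
  | insert a s ha ih =>
    rw [Finset.prod_insert ha, Finset.sum_insert ha, theta_mul, h a (by simp),
      ih fun i hi => h i (Finset.mem_insert_of_mem hi)]
    ring

/-- A power series is determined by its constant coefficient and its logarithmic derivative. -/
theorem coeff_eq_of_theta {f g σ τ : ℝ⟦X⟧} {N : ℕ} (hf : theta f = σ * f) (hg : theta g = τ * g)
    (h0 : coeff 0 f = coeff 0 g) (hσ : coeff 0 σ = 0)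
    (h : ∀ j ≤ N, coeff j σ = coeff j τ) {n : ℕ} (hn : n ≤ N) : coeff n f = coeff n g := by
  induction n using Nat.strong_induction_on with
  | _ n ih =>
    rcases Nat.eq_zero_or_pos n with rfl | hpos
    · exact h0
    have h1 := congrArg (coeff n) hf
    have h2 := congrArg (coeff n) hg
    rw [coeff_theta, coeff_mul] at h1 h2
    have : (n : ℝ) * coeff n f = n * coeff n g := by
      rw [h1, h2]
      refine Finset.sum_congr rfl fun p hp => ?_
      rw [Finset.HasAntidiagonal.mem_antidiagonal] at hp
      rcases Nat.eq_zero_or_pos p.1 with h0' | h0'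
      -- The term of index 0 would involve the unknown coefficient itself; it drops out because σ
      -- has no constant term.
      · rw [h0', ← h 0 (Nat.zero_le _), hσ]
        simp
      · rw [h p.1 (by omega), ih p.2 (by omega) (by omega)]
    exact mul_left_cancel₀ (by positivity) this

/-- The binomial power series `(1 - c t^i)^r`. -/
def binomPow (c : ℝ) (i : ℕ) (r : ℝ) : ℝ⟦X⟧ :=
  (PowerSeries.binomialSeries ℝ r).subst (-(C c * X ^ i) : ℝ⟦X⟧)

theorem hasSubst_binomPow (c : ℝ) {i : ℕ} (hi : i ≠ 0) : HasSubst (-(C c * X ^ i) : ℝ⟦X⟧) :=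
  HasSubst.of_constantCoeff_zero' (by simp [hi])

theorem oneSubPow_eq (i : ℕ) (r : ℝ) : oneSubPow i r = binomPow 1 i r := by
  simp [oneSubPow, binomPow]

theorem coeff_binomPow (c : ℝ) {i : ℕ} (hi : i ≠ 0) (r : ℝ) (n : ℕ) :
    coeff n (binomPow c i r) =
      if i ∣ n then (-c) ^ (n / i) * Ring.choose r (n / i) else 0 := by
  rw [binomPow, coeff_subst' (hasSubst_binomPow c hi)]
  have hc : ∀ m : ℕ, coeff n ((-(C c * X ^ i) : ℝ⟦X⟧) ^ m) =
      if n = i * m then (-c) ^ m else 0 := by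
    intro m
    rw [← neg_mul, mul_pow, ← pow_mul, ← map_neg, ← map_pow, coeff_C_mul, coeff_X_pow]
    split_ifs <;> simp
  simp only [binomialSeries_coeff, hc]
  split_ifs with h
  · obtain ⟨m, rfl⟩ := h
    rw [finsum_eq_single _ m, Nat.mul_div_cancel_left _ (Nat.pos_of_ne_zero hi)]
    · simp [mul_comm]
    · intro k hk
      rw [if_neg, smul_zero]
      intro h
      exact hk (Nat.eq_of_mul_eq_mul_left (Nat.pos_of_ne_zero hi) h).symm
  · refine finsum_eq_zero_of_forall_eq_zero fun m => ?_
    rw [if_neg, smul_zero]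
    rintro rfl
    exact h (dvd_mul_right _ _)

/-- The ratio of consecutive binomial coefficients, read as the differential equation of (1 + t)^r.
-/
theorem derivative_binomialSeries (r : ℝ) :
    (1 + X) * d⁄dX ℝ (PowerSeries.binomialSeries ℝ r) = C r * PowerSeries.binomialSeries ℝ r := by
  ext n
  rw [coeff_C_mul, add_mul, one_mul, map_add]
  cases n with
  | zero =>
    have := choose_succ_mul r 0
    simp only [coeff_derivative, binomialSeries_coeff, smul_eq_mul, coeff_zero_X_mul]
    simp at this ⊢
  | succ n =>
    have := choose_succ_mul r (n + 1)
    rw [coeff_succ_X_mul, coeff_derivative, coeff_derivative]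
    simp only [binomialSeries_coeff, smul_eq_mul, mul_one]
    push_cast at this ⊢
    linarith

/-- The logarithmic derivative of `(1 - c t^i)^{-h}`, namely `i h ∑_{m ≥ 1} c^m t^{im}`. -/
def geomPart (c : ℝ) (i : ℕ) (h : ℝ) : ℝ⟦X⟧ :=
  mk fun j => if i ∣ j ∧ j ≠ 0 then i * h * c ^ (j / i) else 0

theorem geomPart_mul (c : ℝ) {i : ℕ} (hi : i ≠ 0) (h : ℝ) :
    (1 - C c * X ^ i) * geomPart c i h = C (i * h) * (C c * X ^ i) := by
  ext n
  rw [sub_mul, one_mul, map_sub, mul_assoc, coeff_C_mul, coeff_X_pow_mul', coeff_C_mul,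
    coeff_C_mul, coeff_X_pow]
  simp only [geomPart, coeff_mk]
  by_cases hd : i ∣ n
  · obtain ⟨m, rfl⟩ := hd
    have hi' := Nat.pos_of_ne_zero hi
    rcases m with _ | _ | m
    · simp [hi, hi.symm]
    · simp [hi, Nat.div_self hi']
    · have h1 : i ≤ i * (m + 1 + 1) := Nat.le_mul_of_pos_right _ (by omega)
      have h2 : i * (m + 1 + 1) - i = i * (m + 1) := by
        rw [Nat.mul_succ i (m + 1), Nat.add_sub_cancel]
      have h3 : i * (m + 1 + 1) ≠ i := by
        rw [Nat.mul_succ]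
        have : 0 < i * (m + 1) := by positivity
        omega
      rw [if_pos h1, h2, if_pos ⟨dvd_mul_right _ _, by positivity⟩,
        if_pos ⟨dvd_mul_right _ _, by positivity⟩, if_neg h3,
        Nat.mul_div_cancel_left _ hi', Nat.mul_div_cancel_left _ hi']
      ring
  · have h1 : n ≠ i := by
      rintro rfl
      exact hd dvd_rfl
    simp only [hd, false_and, if_false, h1, zero_sub, mul_zero]
    split_ifs with h2 h3
    · exact absurd ((Nat.dvd_sub_iff_left h2 dvd_rfl).1 h3.1) hd
    · simp
    · simp

/-- Substitute -c t^i into the differential equation of (1 + t)^{-h} and use the chain rule. The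
identity appears multiplied by the nonzero series 1 - c t^i, which is cancelled. -/
theorem theta_binomPow (c : ℝ) {i : ℕ} (hi : i ≠ 0) (h : ℝ) :
    theta (binomPow c i (-h)) = geomPart c i h * binomPow c i (-h) := by
  have hs := hasSubst_binomPow c hi
  have hX : (X : ℝ⟦X⟧) * d⁄dX ℝ (-(C c * X ^ i) : ℝ⟦X⟧) = C (i : ℝ) * -(C c * X ^ i) := by
    obtain ⟨k, rfl⟩ := Nat.exists_eq_succ_of_ne_zero hi
    rw [map_neg, Derivation.leibniz, derivative_C, derivative_pow, derivative_X]
    simp only [smul_eq_mul, mul_one, Nat.succ_eq_add_one,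
      Nat.add_sub_cancel, map_natCast, pow_succ]
    ring
  have hD := congrArg (subst (-(C c * X ^ i) : ℝ⟦X⟧)) (derivative_binomialSeries (-h))
  rw [subst_mul hs, subst_mul hs, subst_add hs, subst_X hs, subst_one_eq hs,
    subst_C_eq hs] at hD
  have hne : (1 - C c * X ^ i : ℝ⟦X⟧) ≠ 0 := by
    intro h0
    have := congrArg (coeff 0) h0
    simp [hi] at this
  apply mul_left_cancel₀ hne
  have key : (1 - C c * X ^ i : ℝ⟦X⟧) * theta (binomPow c i (-h)) =
      C (i * h) * (C c * X ^ i) * binomPow c i (-h) := by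
    rw [theta, binomPow, derivative_subst hs]
    have hD' : (1 - C c * X ^ i : ℝ⟦X⟧) *
        subst (-(C c * X ^ i) : ℝ⟦X⟧) (d⁄dX ℝ (PowerSeries.binomialSeries ℝ (-h))) =
        C (-h) * subst (-(C c * X ^ i) : ℝ⟦X⟧) (PowerSeries.binomialSeries ℝ (-h)) := by
      rw [← hD]
      simp [sub_eq_add_neg]
    calc _ = ((1 - C c * X ^ i : ℝ⟦X⟧) *
        subst (-(C c * X ^ i) : ℝ⟦X⟧) (d⁄dX ℝ (PowerSeries.binomialSeries ℝ (-h)))) *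
          (X * d⁄dX ℝ (-(C c * X ^ i) : ℝ⟦X⟧)) := by ring
      _ = _ := by
        rw [hD', hX]
        simp only [map_neg, map_mul]
        ring
  rw [key, ← geomPart_mul c hi, mul_assoc]

theorem coeff_zero_binomPow (c : ℝ) {i : ℕ} (hi : i ≠ 0) (r : ℝ) :
    coeff 0 (binomPow c i r) = 1 := by
  rw [coeff_binomPow c hi]
  simp

theorem theta_logOf {f : ℝ⟦X⟧} (hf : constantCoeff f = 1) : theta (logOf f) * f = theta f := by
  have hs : HasSubst (f - 1) := HasSubst.of_constantCoeff_zero' (by simp [hf])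
  have h1 : (1 + X) * d⁄dX ℝ (log ℝ) = 1 := by
    rw [deriv_log]
    ext n
    rw [add_mul, one_mul, map_add, coeff_one]
    cases n with
    | zero => simp
    | succ n => 
      rw [coeff_succ_X_mul]
      simp [pow_succ]
  have h2 := congrArg (subst (f - 1)) h1
  rw [subst_mul hs, subst_add hs, subst_X hs, subst_one_eq hs] at h2
  rw [theta, theta, logOf_eq, derivative_subst hs]
  have h3 : f * subst (f - 1) (d⁄dX ℝ (log ℝ)) = 1 := by
    simpa using h2
  have h4 : d⁄dX ℝ (f - 1) = d⁄dX ℝ f := by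
    simp
  rw [h4]
  calc _ = (f * subst (f - 1) (d⁄dX ℝ (log ℝ))) * (X * d⁄dX ℝ f) := by ring
    _ = _ := by rw [h3, one_mul]

end

/-! ### The numbers k a_k and h_k and their bounds -/

section
open PowerSeries Finset

theorem coeff_zero_genSeries (d : ℕ → ℝ) : coeff 0 (genSeries d) = 1 := by simp [genSeries]

theorem coeff_genSeries (d : ℕ → ℝ) {k : ℕ} (hk : k ≠ 0) : coeff k (genSeries d) = d k := by
  simp [genSeries, hk]

/-- The coefficients `k a_k` of the logarithmic derivative of `f`. -/
def bSeq (d : ℕ → ℝ) (k : ℕ) : ℝ := k * aSeq d k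

theorem bSeq_zero (d : ℕ → ℝ) : bSeq d 0 = 0 := by simp [bSeq]

theorem theta_genSeries (d : ℕ → ℝ) : theta (genSeries d) = mk (bSeq d) * genSeries d := by
  rw [← theta_logOf (f := genSeries d) (by simp [genSeries])]
  congr 1
  ext n
  rw [coeff_theta, coeff_mk, bSeq, aSeq]

theorem sum_bSeq_mul (d : ℕ → ℝ) (k : ℕ) :
    ((k : ℝ) + 1) * coeff (k + 1) (genSeries d) =
      ∑ j ∈ range (k + 1), bSeq d (j + 1) * coeff (k - j) (genSeries d) := by
  have h := congrArg (coeff (k + 1)) (theta_genSeries d)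
  rw [coeff_theta, coeff_mul, Finset.Nat.sum_antidiagonal_eq_sum_range_succ
    (fun i j => coeff i (mk (bSeq d)) * coeff j (genSeries d)), Finset.sum_range_succ'] at h
  simp only [coeff_mk, bSeq_zero, zero_mul, add_zero, Nat.add_sub_add_right] at h
  push_cast at h
  exact h

theorem bSeq_one (d : ℕ → ℝ) : bSeq d 1 = d 1 := by
  have := sum_bSeq_mul d 0
  simpa [coeff_genSeries, genSeries] using this.symm

/-- Difference of `sum_bSeq_mul` at k + 1 and at k. Its purpose is to have the coefficients of f
enter only through consecutive differences, whose sign is known. -/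
theorem bSeq_succ_succ (d : ℕ → ℝ) (k : ℕ) :
    bSeq d (k + 2) = ((k : ℝ) + 2) * d (k + 2) - ((k : ℝ) + 1) * d (k + 1) +
      ∑ j ∈ range (k + 1), bSeq d (j + 1) *
        (coeff (k - j) (genSeries d) - coeff (k + 1 - j) (genSeries d)) := by
  have h1 := sum_bSeq_mul d k
  have h2 := sum_bSeq_mul d (k + 1)
  rw [Finset.sum_range_succ] at h2
  simp only [Nat.sub_self, coeff_zero_genSeries] at h2
  rw [coeff_genSeries d (Nat.succ_ne_zero _)] at h1 h2
  simp only [mul_sub, Finset.sum_sub_distrib]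
  rw [← h1]
  push_cast at h2
  linarith

/-- The conditions on the sequence `d₁, d₂, …`. -/
structure Admissible (d : ℕ → ℝ) : Prop where
  pos : 0 < d 1
  lt_one : d 1 < 1
  anti : ∀ k : ℕ, 1 ≤ k → d (k + 1) ≤ d k
  incr : ∀ k : ℕ, 1 ≤ k → (k : ℝ) * d k ≤ ((k : ℝ) + 1) * d (k + 1)


theorem apply_le_apply_one {d : ℕ → ℝ} (H : Admissible d) {k : ℕ} (hk : 1 ≤ k) : d k ≤ d 1 := by
  induction k, hk using Nat.le_induction with
  | base => exact le_rfl
  | succ k hk ih => exact (H.anti k hk).trans ih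

theorem coeff_genSeries_antitone {d : ℕ → ℝ} (H : Admissible d) (k : ℕ) :
    coeff (k + 1) (genSeries d) ≤ coeff k (genSeries d) := by
  rcases Nat.eq_zero_or_pos k with rfl | hk
  · rw [coeff_zero_genSeries, coeff_genSeries d (by simp)]
    exact H.lt_one.le
  · rw [coeff_genSeries d (by simp), coeff_genSeries d hk.ne']
    exact H.anti k hk

theorem apply_pos {d : ℕ → ℝ} (H : Admissible d) {k : ℕ} (hk : 1 ≤ k) : 0 < d k := by
  induction k, hk using Nat.le_induction with
  | base => exact H.pos
  | succ k hk ih =>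
    have := H.incr k hk
    have h2 : 0 < (k : ℝ) * d k := by positivity
    exact pos_of_mul_pos_right (h2.trans_le this) (by positivity)

/-- Strong induction on the recurrence. Below, `incr` makes the leading difference nonnegative and
the last summand b_{k+1} (1 - d_1) is positive. Above, replacing every b_j by 1 makes the sum
telescope to 1 - d_{k+1}, which leaves 1 + (k + 2)(d_{k+2} - d_{k+1}) ≤ 1. -/
theorem bSeq_pos_and_lt {d : ℕ → ℝ} (H : Admissible d) (k : ℕ) : 0 < bSeq d (k + 1) ∧ bSeq d (k + 1) < 1 := by
  induction k using Nat.strong_induction_on with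
  | _ k ih =>
    rcases k with _ | k
    · rw [zero_add, bSeq_one]
      exact ⟨H.pos, H.lt_one⟩
    have hE : ∀ j ∈ range (k + 1),
        0 ≤ coeff (k - j) (genSeries d) - coeff (k + 1 - j) (genSeries d) := by
      intro j hj
      have := coeff_genSeries_antitone H (k - j)
      rw [show k - j + 1 = k + 1 - j by have := Finset.mem_range.1 hj; omega] at this
      linarith
    have hk := H.incr (k + 1) (by omega)
    have hm := H.anti (k + 1) (by omega)
    push_cast at hk
    have hlast : coeff (k - k) (genSeries d) - coeff (k + 1 - k) (genSeries d) = 1 - d 1 := by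
      rw [Nat.sub_self, Nat.add_sub_cancel_left, coeff_zero_genSeries, coeff_genSeries d one_ne_zero]
    constructor
    · rw [bSeq_succ_succ]
      have hs : 0 < ∑ j ∈ range (k + 1), bSeq d (j + 1) *
          (coeff (k - j) (genSeries d) - coeff (k + 1 - j) (genSeries d)) := by
        refine Finset.sum_pos' (fun j hj => mul_nonneg (ih j ?_).1.le (hE j hj))
          ⟨k, by simp, ?_⟩
        · exact Finset.mem_range.1 hj
        · rw [hlast]
          exact mul_pos (ih k (by omega)).1 (by linarith [H.lt_one])
      linarith
    · have hs : 0 < ∑ j ∈ range (k + 1), (1 - bSeq d (j + 1)) *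
          (coeff (k - j) (genSeries d) - coeff (k + 1 - j) (genSeries d)) := by
        refine Finset.sum_pos' (fun j hj => mul_nonneg ?_ (hE j hj)) ⟨k, by simp, ?_⟩
        · linarith [(ih j (Finset.mem_range.1 hj)).2]
        · rw [hlast]
          exact mul_pos (by linarith [(ih k (by omega)).2]) (by linarith [H.lt_one])
      have ht : ∑ j ∈ range (k + 1),
          (coeff (k - j) (genSeries d) - coeff (k + 1 - j) (genSeries d)) = 1 - d (k + 1) := by
        have h2 := Finset.sum_range_sub (fun i => coeff (k + 1 - i) (genSeries d)) (k + 1)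
        simp only [Nat.add_sub_add_right, Nat.sub_zero, Nat.sub_self, coeff_zero_genSeries] at h2
        rw [h2, coeff_genSeries d (Nat.succ_ne_zero _)]
      simp only [sub_mul, one_mul, Finset.sum_sub_distrib _ (fun j => bSeq d (j + 1) * _)] at hs
      rw [ht] at hs
      rw [bSeq_succ_succ]
      have : (k : ℝ) * (d (k + 2) - d (k + 1)) ≤ 0 :=
        mul_nonpos_of_nonneg_of_nonpos (by positivity) (by linarith [H.lt_one])
      linarith

theorem aSeq_pos_and_lt {d : ℕ → ℝ} (H : Admissible d) {k : ℕ} (hk : 1 ≤ k) : 0 < aSeq d k ∧ aSeq d k < 1 / (k : ℝ) := by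
  obtain ⟨k, rfl⟩ := Nat.exists_eq_add_of_le' hk
  have hk0 : (0 : ℝ) < (k + 1 : ℕ) := by positivity
  obtain ⟨h2, h3⟩ := bSeq_pos_and_lt H k
  rw [bSeq] at h2 h3
  refine ⟨pos_of_mul_pos_right h2 hk0.le, ?_⟩
  rw [lt_div_iff₀ hk0]
  linarith

/-- b_{k+1} is one of the nonnegative summands that add up to (k + 1) d_{k+1}. This bound is what
later preserves a factor d_1. -/
theorem bSeq_le_mul {d : ℕ → ℝ} (H : Admissible d) (k : ℕ) : bSeq d (k + 1) ≤ (k + 1) * d 1 := by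
  have h2 := sum_bSeq_mul d k
  rw [coeff_genSeries d (Nat.succ_ne_zero _)] at h2
  have h3 : bSeq d (k + 1) * coeff (k - k) (genSeries d) ≤
      ∑ j ∈ range (k + 1), bSeq d (j + 1) * coeff (k - j) (genSeries d) := by
    refine Finset.single_le_sum
      (f := fun j => bSeq d (j + 1) * coeff (k - j) (genSeries d)) (fun j hj => ?_) (by simp)
    refine mul_nonneg (bSeq_pos_and_lt H j).1.le ?_
    rcases Nat.eq_zero_or_pos (k - j) with h | h
    · rw [h, coeff_zero_genSeries]
      exact zero_le_one
    · rw [coeff_genSeries d h.ne']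
      exact (apply_pos H h).le
  rw [Nat.sub_self, coeff_zero_genSeries, mul_one, ← h2] at h3
  exact h3.trans (mul_le_mul_of_nonneg_left (apply_le_apply_one H (by omega)) (by positivity))

/-- The series f ∏_{i ≤ k} (1 - t^i)^{h_i} has no terms in t, …, t^k, so its logarithmic derivative
has zero coefficient at t^k. That coefficient is b_k minus the divisor sum. -/
theorem sum_divisors_hSeq (d : ℕ → ℝ) {k : ℕ} (hk : k ≠ 0) :
    ∑ i ∈ k.divisors, (i : ℝ) * hSeq d i = bSeq d k := by
  set R := genSeries d * ∏ i ∈ Finset.range k, oneSubPow (i + 1) (hSeq d (i + 1)) with hR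
  have hth : theta R = (mk (bSeq d) +
      ∑ i ∈ range k, geomPart 1 (i + 1) (-hSeq d (i + 1))) * R := by
    rw [hR, theta_mul, theta_genSeries, theta_prod (range k) _
      (fun i => geomPart 1 (i + 1) (-hSeq d (i + 1)))]
    · ring
    · intro i _
      have := theta_binomPow 1 (Nat.succ_ne_zero i) (-hSeq d (i + 1))
      rwa [neg_neg, ← oneSubPow_eq] at this
  have h1 := congrArg (coeff k) hth
  rw [coeff_theta, hSeq_spec d k k (by omega), if_neg hk, if_neg (by omega), mul_zero, coeff_mul,
    Finset.sum_eq_single (k, 0)] at h1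
  · rw [hSeq_spec d k 0 (by omega), if_pos rfl, mul_one, map_add, coeff_mk, map_sum] at h1
    have h2 : ∑ i ∈ k.divisors, (i : ℝ) * hSeq d i =
        -∑ i ∈ range k, coeff k (geomPart 1 (i + 1) (-hSeq d (i + 1))) := by
      rw [Nat.divisors, Finset.sum_filter, Finset.sum_Ico_eq_sum_range, ← Finset.sum_neg_distrib,
        Nat.add_sub_cancel]
      refine Finset.sum_congr rfl fun i _ => ?_
      simp only [geomPart, coeff_mk, one_pow, add_comm 1 i, hk, ne_eq, not_false_eq_true, and_true]
      split_ifs <;> simp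
    rw [h2]
    linarith
  · rintro ⟨x, y⟩ hp hne
    rw [Finset.HasAntidiagonal.mem_antidiagonal] at hp
    change x + y = k at hp
    have hy : y ≠ 0 := by
      rintro rfl
      exact hne (by rw [← hp, add_zero])
    rw [hSeq_spec d k y (by omega), if_neg hy, if_neg (by omega), mul_zero]
  · intro h
    exact absurd (by simp) h

theorem hSeq_one (d : ℕ → ℝ) : hSeq d 1 = d 1 := by
  have := sum_divisors_hSeq d one_ne_zero
  simpa [bSeq_one] using this

/-- Möbius inversion writes i h_i as a sum of terms ±b_j or 0, one for each divisor, and i has at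
most i divisors. -/
theorem abs_hSeq_le_of_abs_bSeq_le (d : ℕ → ℝ) {i : ℕ} (hi : i ≠ 0) {B : ℝ}
    (hB : ∀ j, 1 ≤ j → j ≤ i → |bSeq d j| ≤ B) : |hSeq d i| ≤ B := by
  have hB0 : 0 ≤ B := (abs_nonneg _).trans (hB i (Nat.pos_of_ne_zero hi) le_rfl)
  have hmob := (ArithmeticFunction.sum_eq_iff_sum_mul_moebius_eq
    (f := fun i : ℕ => (i : ℝ) * hSeq d i) (g := bSeq d)).1
    (fun n hn => sum_divisors_hSeq d hn.ne') i (Nat.pos_of_ne_zero hi)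
  have h1 : |(i : ℝ) * hSeq d i| ≤ i * B := by
    rw [← hmob]
    refine (Finset.abs_sum_le_sum_abs _ _).trans ?_
    refine (Finset.sum_le_card_nsmul _ _ B fun x hx => ?_).trans ?_
    · rw [Nat.mem_divisorsAntidiagonal] at hx
      rw [abs_mul]
      have hm : |((ArithmeticFunction.moebius x.1 : ℤ) : ℝ)| ≤ 1 := by
        rw [← Int.cast_abs]
        exact_mod_cast ArithmeticFunction.abs_moebius_le_one
      have hx2 : 0 < x.2 := Nat.pos_of_ne_zero fun h => hx.2 (by rw [← hx.1, h, mul_zero])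
      have hb := hB x.2 hx2 (Nat.le_of_dvd (Nat.pos_of_ne_zero hi) ⟨x.1, by rw [← hx.1, mul_comm]⟩)
      calc _ ≤ 1 * |bSeq d x.2| := by gcongr
        _ ≤ B := by linarith
    · rw [nsmul_eq_mul]
      gcongr
      rw [← Nat.map_div_right_divisors, Finset.card_map]
      exact Nat.card_divisors_le_self i
  rw [abs_mul, Nat.abs_cast] at h1
  exact le_of_mul_le_mul_left h1 (by positivity)


theorem abs_hSeq_le_one {d : ℕ → ℝ} (H : Admissible d) {i : ℕ} (hi : i ≠ 0) : |hSeq d i| ≤ 1 := by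
  refine abs_hSeq_le_of_abs_bSeq_le d hi fun j hj _ => ?_
  obtain ⟨j, rfl⟩ := Nat.exists_eq_add_of_le' hj
  obtain ⟨h2, h3⟩ := bSeq_pos_and_lt H j
  rw [abs_of_pos h2]
  exact h3.le

theorem abs_hSeq_le_mul {d : ℕ → ℝ} (H : Admissible d) {i : ℕ} (hi : i ≠ 0) : |hSeq d i| ≤ i * d 1 := by
  refine abs_hSeq_le_of_abs_bSeq_le d hi fun j hj hji => ?_
  obtain ⟨j, rfl⟩ := Nat.exists_eq_add_of_le' hj
  obtain ⟨h2, h3⟩ := bSeq_pos_and_lt H j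
  rw [abs_of_pos h2]
  refine (bSeq_le_mul H j).trans ?_
  have : ((j : ℝ) + 1) ≤ i := by exact_mod_cast hji
  exact mul_le_mul_of_nonneg_right this H.pos.le

end

open Finset

/-! ### The generating series of T over F_q[T] -/

section Counting
variable {F : Type*} [Field F] [Finite F]

theorem mem_monic {N : ℕ} {P : F[X]} :
    P ∈ (finite_monic F N).toFinset ↔ P.Monic ∧ P.natDegree = N := by simp

theorem card_monic (N : ℕ) : #(finite_monic F N).toFinset = Nat.card F ^ N := by
  rw [← Set.ncard_eq_toFinset_card _ (finite_monic F N), ← Nat.card_coe_set_eq]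
  refine (Nat.card_congr (α := {P : F[X] // P.Monic ∧ P.natDegree = N}) ((Polynomial.monicEquivDegreeLT (R := F) N).trans
    (Polynomial.degreeLTEquiv F N).toEquiv)).trans ?_
  rw [Nat.card_fun, Nat.card_fin]

open Classical in
/-- The monic irreducible polynomials of degree `l`. -/
def monicIrreducibles (F : Type*) [Field F] [Finite F] (l : ℕ) : Finset F[X] :=
  {P ∈ (finite_monic F l).toFinset | Irreducible P}

theorem mem_monicIrreducibles {l : ℕ} {P : F[X]} :
    P ∈ monicIrreducibles F l ↔ P.Monic ∧ Irreducible P ∧ P.natDegree = l := by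
  simp only [monicIrreducibles, Finset.mem_filter, mem_monic]
  tauto

theorem card_monicIrreducibles (l : ℕ) : #(monicIrreducibles F l) = primeCount F l := by
  rw [primeCount, ← Set.ncard_coe_finset]
  congr 1
  ext P
  simp [mem_monicIrreducibles]

theorem disjoint_monicIrreducibles (s : Set ℕ) :
    s.PairwiseDisjoint (monicIrreducibles F) := by
  intro i _ j _ hij
  refine Finset.disjoint_left.2 fun P hP hQ => hij ?_
  rw [mem_monicIrreducibles] at hP hQ
  rw [← hP.2.2, ← hQ.2.2]

theorem natDegree_eq_sum_multiplicity {N : ℕ} {Q : F[X]} (hQ : Q.Monic) (hN : Q.natDegree = N) :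
    (N : ℝ) = ∑ l ∈ Icc 1 N, ∑ P ∈ monicIrreducibles F l, (l : ℝ) * multiplicity P Q := by
  classical
  set s := UniqueFactorizationMonoid.normalizedFactors Q with hs
  have hmem : ∀ P ∈ s, P.Monic ∧ Irreducible P ∧ P ∣ Q := by
    intro P hP
    refine ⟨?_, UniqueFactorizationMonoid.irreducible_of_normalized_factor P hP,
      UniqueFactorizationMonoid.dvd_of_mem_normalizedFactors hP⟩
    rw [← UniqueFactorizationMonoid.normalize_normalized_factor P hP]
    exact Polynomial.monic_normalize
      (UniqueFactorizationMonoid.irreducible_of_normalized_factor P hP).ne_zero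
  have hprod : s.prod = Q := by
    rw [hs, UniqueFactorizationMonoid.prod_normalizedFactors_eq hQ.ne_zero, hQ.normalize_eq_self]
  have hdeg : N = ∑ P ∈ s.toFinset, s.count P * P.natDegree := by
    rw [← hN, ← hprod, Polynomial.natDegree_multiset_prod_of_monic _ fun P hP => (hmem P hP).1,
      Finset.sum_multiset_map_count]
    simp
  have hcount : ∀ P ∈ (Icc 1 N).biUnion (monicIrreducibles F),
      s.count P = multiplicity P Q := by
    intro P hP
    obtain ⟨l, -, hl⟩ := Finset.mem_biUnion.1 hP
    rw [mem_monicIrreducibles] at hl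
    rw [UniqueFactorizationMonoid.multiplicity_eq_count_normalizedFactors hl.2.1 hQ.ne_zero,
      hl.1.normalize_eq_self]
  have h1 : ∑ l ∈ Icc 1 N, ∑ P ∈ monicIrreducibles F l, (l : ℝ) * multiplicity P Q =
      ∑ P ∈ (Icc 1 N).biUnion (monicIrreducibles F), (P.natDegree : ℝ) * s.count P := by
    rw [Finset.sum_biUnion (disjoint_monicIrreducibles _)]
    refine Finset.sum_congr rfl fun l hl => Finset.sum_congr rfl fun P hP => ?_
    rw [hcount P (Finset.mem_biUnion.2 ⟨l, hl, hP⟩), (mem_monicIrreducibles.1 hP).2.2]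
  rw [h1]
  conv_lhs => rw [hdeg]
  push_cast
  rw [Finset.sum_congr rfl fun P _ => mul_comm (P.natDegree : ℝ) (s.count P : ℝ)]
  refine Finset.sum_subset (fun P hP => ?_) fun P _ hP => ?_
  · rw [Multiset.mem_toFinset] at hP
    obtain ⟨hm, hi, hd⟩ := hmem P hP
    refine Finset.mem_biUnion.2 ⟨P.natDegree, Finset.mem_Icc.2 ⟨hi.natDegree_pos, ?_⟩,
      mem_monicIrreducibles.2 ⟨hm, hi, rfl⟩⟩
    rw [← hN]
    exact Polynomial.natDegree_le_of_dvd hd hQ.ne_zero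
  · rw [Multiset.mem_toFinset] at hP
    rw [Multiset.count_eq_zero_of_notMem hP]
    simp

variable {g : F[X] → ℝ} {D b : ℕ → ℝ}

-- With Q = P^v G and P ∤ G, both sides are g(G) times the two sides of the recurrence for v D_v.
open Classical in
theorem multiplicity_mul_apply {F : Type*} [Field F] {g : F[X] → ℝ} {D b : ℕ → ℝ} (hg : IsMultiplicative g) (hD : D 0 = 1)
    (hgD : ∀ P : F[X], P.Monic → Irreducible P → ∀ k : ℕ, 1 ≤ k → g (P ^ k) = D k)
    (hb : ∀ v : ℕ, v * D v = ∑ k ∈ Icc 1 v, b k * D (v - k))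
    {N : ℕ} {P Q : F[X]} (hP : P.Monic) (hPi : Irreducible P) (hQ : Q.Monic)
    (hN : Q.natDegree = N) :
    (multiplicity P Q : ℝ) * g Q =
      ∑ k ∈ Icc 1 N, if P ^ k ∣ Q then b k * g (Q / P ^ k) else 0 := by
  have hfin : FiniteMultiplicity P Q := FiniteMultiplicity.of_prime_left hPi.prime hQ.ne_zero
  set v := multiplicity P Q with hv
  have hdvd : ∀ k, P ^ k ∣ Q ↔ k ≤ v := fun k => hfin.pow_dvd_iff_le_multiplicity
  obtain ⟨G, hG, hnd⟩ := hfin.exists_eq_pow_mul_and_not_dvd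
  rw [← hv] at hG
  have hGm : G.Monic := (hP.pow v).of_mul_monic_left (hG ▸ hQ)
  have hpow : ∀ k, g (P ^ k * G) = D k * g G := by
    intro k
    have hc : IsCoprime (P ^ k) G := (hPi.coprime_iff_not_dvd.2 hnd).pow_left
    rw [hg.2 _ _ (hP.pow k) hGm hc]
    rcases Nat.eq_zero_or_pos k with rfl | hk
    · rw [pow_zero, hg.1, hD]
    · rw [hgD P hP hPi k hk]
  have hvN : v ≤ N := by
    have h1 := Polynomial.natDegree_le_of_dvd ((hdvd v).2 le_rfl) hQ.ne_zero
    rw [Polynomial.natDegree_pow, hN] at h1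
    exact (Nat.le_mul_of_pos_right v hPi.natDegree_pos).trans h1
  have h2 : ∀ k ∈ Icc 1 v, (if P ^ k ∣ Q then b k * g (Q / P ^ k) else 0) =
      b k * D (v - k) * g G := by
    intro k hk
    have hkv := (Finset.mem_Icc.1 hk).2
    rw [if_pos ((hdvd k).2 hkv), hG, show P ^ v = P ^ k * P ^ (v - k) by
      rw [← pow_add, Nat.add_sub_cancel' hkv], mul_assoc,
      mul_div_cancel_left₀ _ (pow_ne_zero k hP.ne_zero), hpow]
    ring
  have h3 : ∑ k ∈ Icc 1 N, (if P ^ k ∣ Q then b k * g (Q / P ^ k) else 0) =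
      ∑ k ∈ Icc 1 v, b k * D (v - k) * g G := by
    rw [← Finset.sum_congr rfl h2]
    symm
    refine Finset.sum_subset (Finset.Icc_subset_Icc le_rfl hvN) fun k hk hk' => ?_
    rw [if_neg]
    rw [hdvd]
    intro h
    exact hk' (Finset.mem_Icc.2 ⟨(Finset.mem_Icc.1 hk).1, h⟩)
  rw [h3, ← Finset.sum_mul, ← hb]
  conv_lhs => rw [hG, hpow]
  ring

open Classical in
theorem sum_pow_dvd {N l : ℕ} (c : ℝ) {P : F[X]} (hP : P.Monic)
    (hl : P.natDegree = l) (k : ℕ) :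
    ∑ Q ∈ (finite_monic F N).toFinset, (if P ^ k ∣ Q then c * g (Q / P ^ k) else 0) =
      if l * k ≤ N then c * T g (N - l * k) else 0 := by
  have hdeg : (P ^ k).natDegree = l * k := by rw [Polynomial.natDegree_pow, hl, mul_comm]
  have hm := hP.pow k
  split_ifs with h
  · rw [T, ← Finset.sum_filter, Finset.mul_sum]
    symm
    refine Finset.sum_nbij' (fun G => P ^ k * G) (fun Q => Q / P ^ k) ?_ ?_ ?_ ?_ ?_
    · intro G hG
      rw [mem_monic] at hG
      rw [Finset.mem_filter, mem_monic]
      refine ⟨⟨hm.mul hG.1, ?_⟩, dvd_mul_right _ _⟩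
      rw [hm.natDegree_mul hG.1, hdeg, hG.2]
      omega
    · intro Q hQ
      rw [Finset.mem_filter, mem_monic] at hQ
      obtain ⟨⟨h1, h2⟩, G, rfl⟩ := hQ
      have hG : G.Monic := hm.of_mul_monic_left h1
      rw [hm.natDegree_mul hG, hdeg] at h2
      rw [mul_div_cancel_left₀ _ hm.ne_zero, mem_monic]
      exact ⟨hG, by omega⟩
    · intro G _
      exact mul_div_cancel_left₀ _ hm.ne_zero
    · intro Q hQ
      rw [Finset.mem_filter] at hQ
      obtain ⟨_, G, rfl⟩ := hQ
      simp only [mul_div_cancel_left₀ _ hm.ne_zero]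
    · intro G _
      simp only [mul_div_cancel_left₀ _ hm.ne_zero]
  · refine Finset.sum_eq_zero fun Q hQ => if_neg fun hd => h ?_
    rw [mem_monic] at hQ
    rw [← hdeg, ← hQ.2]
    exact Polynomial.natDegree_le_of_dvd hd hQ.1.ne_zero

-- Weight each Q by its degree, written as the sum of deg P · v_P(Q), and exchange the sums.
-- Division by P^k then sends the multiples of P^k of degree N bijectively to the monic polynomials
-- of degree N - lk.
open Classical in
theorem mul_T_eq_sum (hg : IsMultiplicative g) (hD : D 0 = 1)
    (hgD : ∀ P : F[X], P.Monic → Irreducible P → ∀ k : ℕ, 1 ≤ k → g (P ^ k) = D k)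
    (hb : ∀ v : ℕ, v * D v = ∑ k ∈ Icc 1 v, b k * D (v - k)) (N : ℕ) :
    (N : ℝ) * T g N = ∑ l ∈ Icc 1 N, ∑ k ∈ Icc 1 N,
      if l * k ≤ N then l * primeCount F l * b k * T g (N - l * k) else 0 := by
  calc (N : ℝ) * T g N = ∑ Q ∈ (finite_monic F N).toFinset,
        ∑ l ∈ Icc 1 N, ∑ P ∈ monicIrreducibles F l, ∑ k ∈ Icc 1 N,
          (if P ^ k ∣ Q then (l * b k) * g (Q / P ^ k) else 0) := by
        rw [T, Finset.mul_sum]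
        refine Finset.sum_congr rfl fun Q hQ => ?_
        rw [mem_monic] at hQ
        rw [natDegree_eq_sum_multiplicity hQ.1 hQ.2, Finset.sum_mul]
        refine Finset.sum_congr rfl fun l _ => ?_
        rw [Finset.sum_mul]
        refine Finset.sum_congr rfl fun P hP => ?_
        rw [mem_monicIrreducibles] at hP
        rw [mul_assoc, multiplicity_mul_apply hg hD hgD hb hP.1 hP.2.1 hQ.1 hQ.2, Finset.mul_sum]
        refine Finset.sum_congr rfl fun k _ => ?_
        split_ifs
        · ring
        · simp
    _ = ∑ l ∈ Icc 1 N, ∑ P ∈ monicIrreducibles F l, ∑ k ∈ Icc 1 N,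
          (if l * k ≤ N then (l * b k) * T g (N - l * k) else 0) := by
        rw [Finset.sum_comm]
        refine Finset.sum_congr rfl fun l _ => ?_
        rw [Finset.sum_comm]
        refine Finset.sum_congr rfl fun P hP => ?_
        rw [Finset.sum_comm]
        refine Finset.sum_congr rfl fun k _ => ?_
        rw [mem_monicIrreducibles] at hP
        exact sum_pow_dvd _ hP.1 hP.2.2 k
    _ = _ := by
        refine Finset.sum_congr rfl fun l _ => ?_
        rw [Finset.sum_const, card_monicIrreducibles, nsmul_eq_mul, Finset.mul_sum]
        refine Finset.sum_congr rfl fun k _ => ?_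
        split_ifs
        · ring
        · simp

theorem sum_divisorsAntidiagonal_mul (f : ℕ → ℕ → ℝ) (t : ℕ → ℝ) (N : ℕ) :
    ∑ l ∈ Icc 1 N, ∑ k ∈ Icc 1 N, (if l * k ≤ N then f l k * t (N - l * k) else 0) =
      ∑ p ∈ HasAntidiagonal.antidiagonal N,
        (∑ x ∈ p.1.divisorsAntidiagonal, f x.1 x.2) * t p.2 := by
  rw [Finset.Nat.sum_antidiagonal_eq_sum_range_succ
    (fun i j => (∑ x ∈ i.divisorsAntidiagonal, f x.1 x.2) * t j), ← Finset.sum_product',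
    ← Finset.sum_filter]
  simp only [Finset.sum_mul]
  rw [Finset.sum_sigma']
  refine Finset.sum_nbij' (fun x => ⟨x.1 * x.2, x⟩) (fun y => y.2) ?_ ?_ ?_ ?_ ?_
  · rintro ⟨l, k⟩ hx
    simp only [Finset.mem_filter, Finset.mem_product, Finset.mem_Icc] at hx
    simp only [Finset.mem_sigma, Finset.mem_range, Nat.mem_divisorsAntidiagonal, true_and]
    exact ⟨by omega, mul_ne_zero (by omega) (by omega)⟩
  · rintro ⟨j, l, k⟩ hy
    simp only [Finset.mem_sigma, Finset.mem_range, Nat.mem_divisorsAntidiagonal] at hy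
    obtain ⟨h1, rfl, h2⟩ := hy
    have hl : 0 < l := Nat.pos_of_ne_zero (left_ne_zero_of_mul h2)
    have hk : 0 < k := Nat.pos_of_ne_zero (right_ne_zero_of_mul h2)
    simp only [Finset.mem_filter, Finset.mem_product, Finset.mem_Icc]
    have := Nat.le_mul_of_pos_right l hk
    have := Nat.le_mul_of_pos_left k hl
    omega
  · rintro ⟨l, k⟩ _
    rfl
  · rintro ⟨j, l, k⟩ hy
    simp only [Finset.mem_sigma, Finset.mem_range, Nat.mem_divisorsAntidiagonal] at hy
    obtain ⟨_, rfl, _⟩ := hy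
    rfl
  · rintro ⟨l, k⟩ _
    rfl

/-- D and b are kept general because the result serves twice: D = b = 1 for counting irreducibles,
and the coefficients of f with `bSeq d` for the given function. -/
theorem theta_mk_T (hg : IsMultiplicative g) (hD : D 0 = 1)
    (hgD : ∀ P : F[X], P.Monic → Irreducible P → ∀ k : ℕ, 1 ≤ k → g (P ^ k) = D k)
    (hb : ∀ v : ℕ, v * D v = ∑ k ∈ Icc 1 v, b k * D (v - k)) :
    theta (PowerSeries.mk (T g)) = PowerSeries.mk
      (fun j => ∑ x ∈ j.divisorsAntidiagonal, (x.1 : ℝ) * primeCount F x.1 * b x.2) *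
        PowerSeries.mk (T g) := by
  ext N
  rw [coeff_theta, PowerSeries.coeff_mul]
  simp only [PowerSeries.coeff_mk]
  rw [mul_T_eq_sum hg hD hgD hb,
    sum_divisorsAntidiagonal_mul (fun l k => (l : ℝ) * primeCount F l * b k)]

/-- For g = 1 one has T(N) = q^N, so the generating series is 1/(1 - qt); its logarithmic
derivative, computed directly, is compared with `theta_mk_T`. -/
theorem sum_divisors_primeCount {j : ℕ} (hj : j ≠ 0) :
    ∑ l ∈ j.divisors, (l : ℝ) * primeCount F l = (Nat.card F : ℝ) ^ j := by
  have h1 : theta (PowerSeries.mk (T fun _ : F[X] => 1)) = PowerSeries.mk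
      (fun j => ∑ x ∈ j.divisorsAntidiagonal, (x.1 : ℝ) * primeCount F x.1 * 1) *
        PowerSeries.mk (T fun _ : F[X] => 1) := by
    refine theta_mk_T (D := fun _ => 1) (b := fun _ => 1) ⟨rfl, by simp⟩ rfl (by simp) ?_
    simp
  have hT : ∀ N, T (fun _ : F[X] => 1) N = (Nat.card F : ℝ) ^ N := by
    intro N
    rw [T, Finset.sum_const, card_monic]
    simp
  have h2 : theta (PowerSeries.mk (T fun _ : F[X] => 1)) = geomPart (Nat.card F) 1 1 *
        PowerSeries.mk (T fun _ : F[X] => 1) := by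
    ext N
    rw [coeff_theta, PowerSeries.coeff_mul, Finset.Nat.sum_antidiagonal_eq_sum_range_succ
      (fun i j => PowerSeries.coeff i (geomPart (Nat.card F) 1 1) *
        PowerSeries.coeff j (PowerSeries.mk (T fun _ : F[X] => 1))), Finset.sum_range_succ']
    simp only [PowerSeries.coeff_mk, hT, geomPart]
    have : ∀ k ∈ range N, (if 1 ∣ k + 1 ∧ k + 1 ≠ 0 then
        ((1 : ℕ) : ℝ) * 1 * (Nat.card F : ℝ) ^ ((k + 1) / 1) else 0) *
          (Nat.card F : ℝ) ^ (N - (k + 1)) = (Nat.card F : ℝ) ^ N := by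
      intro k hk
      rw [if_pos (by simp), Nat.div_one, Nat.cast_one, one_mul, one_mul, ← pow_add]
      congr 1
      have := Finset.mem_range.1 hk
      omega
    rw [Finset.sum_congr rfl this]
    simp
  have hne : PowerSeries.mk (T fun _ : F[X] => 1) ≠ 0 := by
    intro h
    have := congrArg (PowerSeries.coeff 0) h
    simp [hT] at this
  have h3 := congrArg (PowerSeries.coeff j) (mul_right_cancel₀ hne (h1.symm.trans h2))
  simp only [PowerSeries.coeff_mk, mul_one] at h3
  rw [Nat.sum_divisorsAntidiagonal fun l _ => (l : ℝ) * primeCount F l] at h3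
  simpa [geomPart, hj] using h3

/-- The logarithmic derivative of the generating function of `T` in terms of the numbers `h_i`. -/
theorem sum_primeCount_mul_bSeq (d : ℕ → ℝ) (j : ℕ) :
    ∑ x ∈ j.divisorsAntidiagonal, (x.1 : ℝ) * primeCount F x.1 * bSeq d x.2 =
      ∑ x ∈ j.divisorsAntidiagonal, (x.1 : ℝ) * hSeq d x.1 * (Nat.card F : ℝ) ^ x.2 := by
  let p : ArithmeticFunction ℝ := ⟨fun l => (l : ℝ) * primeCount F l, by simp⟩
  let e : ArithmeticFunction ℝ := ⟨fun l => (l : ℝ) * hSeq d l, by simp⟩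
  let b : ArithmeticFunction ℝ := ⟨bSeq d, bSeq_zero d⟩
  let w : ArithmeticFunction ℝ := ⟨fun j => if j = 0 then 0 else (Nat.card F : ℝ) ^ j, by simp⟩
  have hb : b = e * (ArithmeticFunction.zeta : ArithmeticFunction ℝ) := by
    ext k
    rcases Nat.eq_zero_or_pos k with rfl | hk
    · simp
    rw [ArithmeticFunction.coe_mul_zeta_apply]
    exact (sum_divisors_hSeq d hk.ne').symm
  have hw : w = p * (ArithmeticFunction.zeta : ArithmeticFunction ℝ) := by
    ext k
    rcases Nat.eq_zero_or_pos k with rfl | hk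
    · simp
    rw [ArithmeticFunction.coe_mul_zeta_apply]
    refine Eq.trans ?_ (sum_divisors_primeCount hk.ne').symm
    simp [w, hk.ne']
  -- For Dirichlet convolution b = e ζ and w = p ζ, so both sides equal p e ζ.
  have h : p * b = e * w := by
    rw [hb, hw]
    ring
  have h2 := congrArg (fun f : ArithmeticFunction ℝ => f j) h
  simp only [ArithmeticFunction.mul_apply] at h2
  refine h2.trans (Finset.sum_congr rfl fun x hx => ?_)
  rw [Nat.mem_divisorsAntidiagonal] at hx
  have : x.2 ≠ 0 := fun h0 => hx.2 (by rw [← hx.1, h0, mul_zero])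
  change (x.1 : ℝ) * hSeq d x.1 * (if x.2 = 0 then 0 else (Nat.card F : ℝ) ^ x.2) = _
  rw [if_neg this]

theorem theta_mk_T_of_genSeries {d : ℕ → ℝ} (hg : IsMultiplicative g)
    (hgd : ∀ P : F[X], P.Monic → Irreducible P → ∀ k : ℕ, 1 ≤ k → g (P ^ k) = d k) :
    theta (PowerSeries.mk (T g)) = PowerSeries.mk (fun j => ∑ x ∈ j.divisorsAntidiagonal,
      (x.1 : ℝ) * hSeq d x.1 * (Nat.card F : ℝ) ^ x.2) * PowerSeries.mk (T g) := by
  simp only [← sum_primeCount_mul_bSeq]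
  refine theta_mk_T (D := fun k => PowerSeries.coeff k (genSeries d)) hg
    (coeff_zero_genSeries d) (fun P hP hPi k hk => ?_) fun v => ?_
  · rw [hgd P hP hPi k hk, coeff_genSeries d (by omega)]
  · rcases v with _ | v
    · simp
    · have := sum_bSeq_mul d v
      push_cast
      rw [this, show Icc 1 (v + 1) = Ico 1 (v + 2) by ext; simp; omega,
        Finset.sum_Ico_eq_sum_range]
      refine Finset.sum_congr (by simp) fun j _ => ?_
      rw [add_comm 1 j, Nat.add_sub_add_right]

theorem T_zero (hg : IsMultiplicative g) : T g 0 = 1 := by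
  have : (finite_monic F 0).toFinset = {1} := by
    ext P
    rw [mem_monic, Finset.mem_singleton]
    constructor
    · rintro ⟨h1, h2⟩
      exact h1.natDegree_eq_zero.1 h2
    · rintro rfl
      exact ⟨Polynomial.monic_one, Polynomial.natDegree_one⟩
  rw [T, this, Finset.sum_singleton, hg.1]

end Counting

/-! ### T(N) as a polynomial in q -/

theorem prod_fin_castLE {R : Type*} [CommMonoid R] {a b : ℕ} (h : a ≤ b) (φ : Fin b → R)
    (hφ : ∀ i : Fin b, a ≤ i → φ i = 1) : ∏ i, φ i = ∏ i : Fin a, φ (Fin.castLE h i) := by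
  obtain ⟨c, rfl⟩ := Nat.exists_eq_add_of_le h
  rw [Fin.prod_univ_add, Finset.prod_eq_one (s := univ) (f := fun i => φ (Fin.natAdd a i)),
    mul_one]
  · rfl
  · intro i _
    exact hφ _ (by simp)

theorem sum_fin_castLE {R : Type*} [AddCommMonoid R] {a b : ℕ} (h : a ≤ b) (φ : Fin b → R)
    (hφ : ∀ i : Fin b, a ≤ i → φ i = 0) : ∑ i, φ i = ∑ i : Fin a, φ (Fin.castLE h i) :=
  prod_fin_castLE (R := Multiplicative R) h φ hφ

/-- The tuples `(k₁, …, k_M)` with `∑ i k_i = N` and `∑ (i - 1) k_i = l`. -/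
def tuples (M l N : ℕ) : Finset (Fin M → ℕ) :=
  (Fintype.piFinset fun _ : Fin M => Finset.range (N + 1)).filter
    (fun k => ∑ i : Fin M, ((i : ℕ) + 1) * k i = N ∧ ∑ i : Fin M, (i : ℕ) * k i = l)

/-- The product of binomial coefficients attached to a tuple. -/
def binomTerm (d : ℕ → ℝ) {M : ℕ} (k : Fin M → ℕ) : ℝ :=
  (∏ i : Fin M, Ring.choose (-hSeq d (i + 1)) (k i)) * (-1) ^ (∑ i, k i)

theorem mem_tuples {M l N : ℕ} {k : Fin M → ℕ} :
    k ∈ tuples M l N ↔ ∑ i : Fin M, ((i : ℕ) + 1) * k i = N ∧ ∑ i : Fin M, (i : ℕ) * k i = l := by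
  rw [tuples, Finset.mem_filter, Fintype.mem_piFinset, and_iff_right_iff_imp]
  rintro ⟨h, -⟩ i
  rw [Finset.mem_range, Nat.lt_succ_iff, ← h]
  refine (Nat.le_mul_of_pos_left _ (Nat.succ_pos _)).trans
    (Finset.single_le_sum (f := fun i : Fin M => ((i : ℕ) + 1) * k i) (fun _ _ => Nat.zero_le _)
      (Finset.mem_univ i))

theorem A_eq_sum_tuples (d : ℕ → ℝ) (l N : ℕ) :
    A d l N = ∑ k ∈ tuples (l + 1) l N, binomTerm d k := rfl

theorem apply_eq_zero_of_mem_tuples {M l N : ℕ} {k : Fin M → ℕ} (hk : k ∈ tuples M l N)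
    {i : Fin M} (hi : l + 1 ≤ i) : k i = 0 := by
  rw [mem_tuples] at hk
  have h1 : (i : ℕ) * k i ≤ l := hk.2 ▸ Finset.single_le_sum
    (f := fun i : Fin M => (i : ℕ) * k i) (fun _ _ => Nat.zero_le _) (Finset.mem_univ i)
  by_contra h
  have := Nat.le_mul_of_pos_right (i : ℕ) (Nat.pos_of_ne_zero h)
  omega

/-- The second equation forces all entries beyond the first l + 1 to vanish, so the length of the
tuples is immaterial. For fixed N this lets every A_l(N) be read off tuples of the common length N.
-/
theorem sum_tuples_eq (d : ℕ → ℝ) {M l : ℕ} (N : ℕ) (hM : l + 1 ≤ M) :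
    ∑ k ∈ tuples M l N, binomTerm d k = A d l N := by
  rw [A_eq_sum_tuples]
  have hres : ∀ k ∈ tuples M l N, (fun i => k (Fin.castLE hM i)) ∈ tuples (l + 1) l N ∧
      binomTerm d k = binomTerm d (fun i => k (Fin.castLE hM i)) := by
    intro k hk
    have h0 : ∀ i : Fin M, l + 1 ≤ i → k i = 0 := fun i hi => apply_eq_zero_of_mem_tuples hk hi
    rw [mem_tuples] at hk ⊢
    rw [sum_fin_castLE hM _ (fun i hi => by rw [h0 i hi, mul_zero]),
      sum_fin_castLE hM _ (fun i hi => by rw [h0 i hi, mul_zero])] at hk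
    refine ⟨hk, ?_⟩
    rw [binomTerm, binomTerm, sum_fin_castLE hM _ (fun i hi => h0 i hi),
      prod_fin_castLE hM _ (fun i hi => by rw [h0 i hi, Ring.choose_zero_right])]
    rfl
  refine Finset.sum_nbij' (fun k i => k (Fin.castLE hM i))
    (fun k i => if h : (i : ℕ) < l + 1 then k ⟨i, h⟩ else 0) (fun k hk => (hres k hk).1) ?_ ?_ ?_
    (fun k hk => (hres k hk).2)
  · intro k hk
    rw [mem_tuples] at hk ⊢
    rw [sum_fin_castLE hM _ (fun i hi => by rw [dif_neg (by omega), mul_zero]),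
      sum_fin_castLE hM _ (fun i hi => by rw [dif_neg (by omega), mul_zero])]
    have he : ∀ i : Fin (l + 1), (if h : ((Fin.castLE hM i : Fin M) : ℕ) < l + 1 then
        k ⟨(Fin.castLE hM i : Fin M), h⟩ else 0) = k i := fun i => dif_pos i.2
    simp only [he]
    exact hk
  · intro k hk
    funext i
    dsimp only
    split_ifs with h
    · rfl
    · exact (apply_eq_zero_of_mem_tuples hk (by omega)).symm
  · intro k _
    funext i
    exact dif_pos i.2

/-- A tuple contributes q to the power ∑ k_i = N - l, where l = ∑ (i - 1) k_i. The value l = N would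
force k = 0, hence the range l < N. -/
theorem coeff_prod_binomPow (d : ℕ → ℝ) (q : ℝ) {N : ℕ} (hN : N ≠ 0) :
    PowerSeries.coeff N (∏ i : Fin N, binomPow q (i + 1) (-hSeq d (i + 1))) =
      ∑ l ∈ range N, A d l N * q ^ (N - l) := by
  classical
  set S : Finset (Fin N → ℕ) := (Fintype.piFinset fun _ : Fin N => Finset.range (N + 1)).filter
    (fun k => ∑ i : Fin N, ((i : ℕ) + 1) * k i = N) with hS
  have hmem : ∀ k, k ∈ S ↔ ∑ i : Fin N, ((i : ℕ) + 1) * k i = N := by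
    intro k
    constructor
    · intro h
      exact (Finset.mem_filter.1 h).2
    · intro h
      have := (mem_tuples (k := k)).2 ⟨h, rfl⟩
      rw [tuples, Finset.mem_filter] at this
      exact Finset.mem_filter.2 ⟨this.1, h⟩
  have hsum : ∀ k : Fin N → ℕ, ∑ i : Fin N, ((i : ℕ) + 1) * k i = N →
      ∑ i, k i = N - ∑ i : Fin N, (i : ℕ) * k i := by
    intro k hk
    simp only [add_mul, one_mul, Finset.sum_add_distrib] at hk
    omega
  have h1 : PowerSeries.coeff N (∏ i : Fin N, binomPow q (i + 1) (-hSeq d (i + 1))) =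
      ∑ k ∈ S, binomTerm d k * q ^ (∑ i, k i) := by
    rw [PowerSeries.coeff_prod]
    simp only [coeff_binomPow q (Nat.succ_ne_zero _)]
    rw [← Finset.sum_filter_add_sum_filter_not _ (fun κ : Fin N →₀ ℕ => ∀ i : Fin N, (i : ℕ) + 1 ∣ κ i),
      Finset.sum_eq_zero (s := Finset.filter (fun κ : Fin N →₀ ℕ => ¬ ∀ i : Fin N, (i : ℕ) + 1 ∣ κ i) _),
      add_zero]
    · refine Finset.sum_nbij' (fun κ (i : Fin N) => κ i / ((i : ℕ) + 1))
        (fun k => Finsupp.equivFunOnFinite.symm fun i => (i + 1) * k i) ?_ ?_ ?_ ?_ ?_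
      · intro κ hκ
        rw [Finset.mem_filter, Finset.mem_finsuppAntidiag] at hκ
        rw [hmem]
        refine Eq.trans (Finset.sum_congr rfl fun i _ => ?_) hκ.1.1
        exact Nat.mul_div_cancel' (hκ.2 i)
      · intro k hk
        rw [hmem] at hk
        rw [Finset.mem_filter, Finset.mem_finsuppAntidiag]
        refine ⟨⟨hk, Finset.subset_univ _⟩, fun i => dvd_mul_right _ _⟩
      · intro κ hκ
        rw [Finset.mem_filter] at hκ
        ext i
        exact Nat.mul_div_cancel' (hκ.2 i)
      · intro k _
        funext i
        exact Nat.mul_div_cancel_left _ (Nat.succ_pos _)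
      · intro κ hκ
        rw [Finset.mem_filter] at hκ
        rw [binomTerm, ← Finset.prod_pow_eq_pow_sum, ← Finset.prod_pow_eq_pow_sum,
          ← Finset.prod_mul_distrib, ← Finset.prod_mul_distrib]
        refine Finset.prod_congr rfl fun i _ => ?_
        rw [if_pos (hκ.2 i), neg_pow]
        ring
    · intro κ hκ
      rw [Finset.mem_filter, not_forall] at hκ
      obtain ⟨i, hi⟩ := hκ.2
      exact Finset.prod_eq_zero (Finset.mem_univ i) (if_neg hi)
  rw [h1, ← Finset.sum_fiberwise_of_maps_to (t := range N)
    (g := fun k => ∑ i : Fin N, (i : ℕ) * k i)]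
  · refine Finset.sum_congr rfl fun l hl => ?_
    rw [← sum_tuples_eq d N (Nat.succ_le_of_lt (Finset.mem_range.1 hl)), Finset.sum_mul]
    refine Finset.sum_congr ?_ fun k hk => ?_
    · ext k
      rw [Finset.mem_filter, hmem, mem_tuples]
    · rw [mem_tuples] at hk
      rw [hsum k hk.1, hk.2]
  · intro k hk
    rw [hmem] at hk
    rw [Finset.mem_range]
    by_contra h
    have h2 := hsum k hk
    rw [Nat.sub_eq_zero_of_le (by omega), Finset.sum_eq_zero_iff] at h2
    refine hN ?_
    rw [← hk]
    exact Finset.sum_eq_zero fun i hi => by rw [h2 i hi, mul_zero]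

theorem sum_coeff_geomPart (d : ℕ → ℝ) (q : ℝ) {j N : ℕ} (hj : j ≤ N) :
    ∑ x ∈ j.divisorsAntidiagonal, (x.1 : ℝ) * hSeq d x.1 * q ^ x.2 =
      PowerSeries.coeff j (∑ i : Fin N, geomPart q (i + 1) (hSeq d (i + 1))) := by
  rw [Nat.sum_divisorsAntidiagonal (fun a b => (a : ℝ) * hSeq d a * q ^ b), map_sum,
    ← Finset.sum_range fun i => PowerSeries.coeff j (geomPart q (i + 1) (hSeq d (i + 1)))]
  rcases Nat.eq_zero_or_pos j with rfl | hj0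
  · simp [geomPart]
  have h1 : j.divisors = (Ico 1 (N + 1)).filter (· ∣ j) := by
    ext i
    simp only [Nat.mem_divisors, Finset.mem_filter, Finset.mem_Ico]
    constructor
    · rintro ⟨h, _⟩
      have := Nat.le_of_dvd hj0 h
      exact ⟨⟨Nat.pos_of_dvd_of_pos h hj0, by omega⟩, h⟩
    · rintro ⟨_, h⟩
      exact ⟨h, hj0.ne'⟩
  rw [h1, Finset.sum_filter, Finset.sum_Ico_eq_sum_range, Nat.add_sub_cancel]
  refine Finset.sum_congr rfl fun i _ => ?_
  simp only [geomPart, PowerSeries.coeff_mk, add_comm 1 i, hj0.ne', ne_eq, not_false_eq_true,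
    and_true]

/-- `T(N)` is a polynomial in `q` with coefficients `A_l(N)`. -/
theorem T_eq_sum_A {F : Type*} [Field F] [Finite F] {g : F[X] → ℝ} {d : ℕ → ℝ}
    (hg : IsMultiplicative g)
    (hgd : ∀ P : F[X], P.Monic → Irreducible P → ∀ k : ℕ, 1 ≤ k → g (P ^ k) = d k)
    {N : ℕ} (hN : N ≠ 0) :
    T g N = ∑ l ∈ range N, A d l N * (Nat.card F : ℝ) ^ (N - l) := by
  rw [← coeff_prod_binomPow d _ hN, ← PowerSeries.coeff_mk N (T g)]
  -- Factors with i > N do not influence coefficients up to t^N, so a finite product is enough.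
  refine coeff_eq_of_theta (N := N) (theta_mk_T_of_genSeries hg hgd)
    (theta_prod univ _ (fun i : Fin N => geomPart (Nat.card F) (i + 1) (hSeq d (i + 1)))
      fun i _ => theta_binomPow _ (Nat.succ_ne_zero _) _) ?_ ?_ ?_ le_rfl
  · rw [PowerSeries.coeff_mk, T_zero hg, PowerSeries.coeff_zero_eq_constantCoeff_apply, map_prod]
    symm
    refine Finset.prod_eq_one fun i _ => ?_
    rw [← PowerSeries.coeff_zero_eq_constantCoeff_apply]
    exact coeff_zero_binomPow _ (Nat.succ_ne_zero _) _
  · simp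
  · intro j hj
    rw [PowerSeries.coeff_mk]
    exact sum_coeff_geomPart d _ hj

/-! ### Bounds for A_l(N) -/

/-- k_{i+1} is read as the multiplicity of the part i in a partition of l. `Nat.Partition.ofSums`
discards the zeros coming from k_1, and k_1 is recovered from the equation with right-hand side N.
-/
theorem card_tuples_le (l N : ℕ) : #(tuples (l + 1) l N) ≤ Fintype.card (Nat.Partition l) := by
  classical
  have hs : ∀ k ∈ tuples (l + 1) l N,
      (∑ i : Fin (l + 1), Multiset.replicate (k i) (i : ℕ)).sum = l := by
    intro k hk
    rw [mem_tuples] at hk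
    refine Eq.trans ?_ hk.2
    rw [← Multiset.coe_sumAddMonoidHom, map_sum]
    refine Finset.sum_congr rfl fun i _ => ?_
    simp [mul_comm]
  rw [← Finset.card_attach, ← Finset.card_univ]
  refine Finset.card_le_card_of_injOn
    (fun k => Nat.Partition.ofSums l _ (hs k.1 k.2)) (fun _ _ => Finset.mem_univ _) ?_
  rintro ⟨k, hk⟩ - ⟨m, hm⟩ - h
  have hcount : ∀ (k : Fin (l + 1) → ℕ) (i : Fin (l + 1)),
      Multiset.count (i : ℕ) (∑ j : Fin (l + 1), Multiset.replicate (k j) (j : ℕ)) = k i := by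
    intro k i
    rw [Multiset.count_sum', Finset.sum_eq_single i]
    · simp
    · intro j _ hj
      rw [Multiset.count_replicate, if_neg]
      exact fun h => hj (Fin.ext h)
    · simp
  have h1 : ∀ i : Fin (l + 1), (i : ℕ) ≠ 0 → k i = m i := by
    intro i hi
    have := congrArg (fun p : Nat.Partition l => p.parts.count (i : ℕ)) h
    simp only [Nat.Partition.count_ofSums_of_ne_zero _ hi, hcount] at this
    exact this
  have h2 : ∀ i : Fin l, k i.succ = m i.succ := fun i => h1 _ (by simp)
  rw [mem_tuples, Fin.sum_univ_succ] at hk hm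
  have h3 : k 0 = m 0 := by
    have ha := hk.1
    have hb := hm.1
    simp only [h2] at ha
    simp at ha hb
    omega
  refine Subtype.ext (funext fun i => ?_)
  rcases Fin.eq_zero_or_eq_succ i with rfl | ⟨j, rfl⟩
  · exact h3
  · exact h2 j

theorem card_partition_le (l : ℕ) : Fintype.card (Nat.Partition l) ≤ 2 ^ l := by
  refine (Fintype.card_le_of_surjective _ Nat.Partition.ofComposition_surj).trans ?_
  rw [composition_card]
  exact Nat.pow_le_pow_right two_pos (Nat.sub_le _ _)

theorem abs_choose_neg_le_one {h : ℝ} (hh : |h| ≤ 1) (k : ℕ) : |Ring.choose (-h) k| ≤ 1 := by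
  induction k with
  | zero => simp
  | succ k ih =>
    have h1 := congrArg abs (choose_succ_mul (-h) k)
    rw [abs_mul, abs_mul, abs_of_pos (by positivity : (0 : ℝ) < k + 1)] at h1
    have h2 : |-h - (k : ℝ)| ≤ 1 * (k + 1) := by
      rw [abs_le] at hh ⊢
      constructor <;> linarith [(Nat.cast_nonneg k : (0 : ℝ) ≤ k)]
    refine le_of_mul_le_mul_right (a := (k : ℝ) + 1) ?_ (by positivity)
    rw [h1]
    exact (mul_le_mul ih h2 (abs_nonneg _) zero_le_one).trans (by linarith)

theorem abs_choose_neg_le_abs {h : ℝ} (hh : |h| ≤ 1) (k : ℕ) :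
    |Ring.choose (-h) (k + 1)| ≤ |h| := by
  induction k with
  | zero => simp
  | succ k ih =>
    have h1 := congrArg abs (choose_succ_mul (-h) (k + 1))
    rw [abs_mul, abs_mul, abs_of_pos (by positivity : (0 : ℝ) < (k + 1 : ℕ) + 1)] at h1
    have h2 : |-h - ((k + 1 : ℕ) : ℝ)| ≤ (k + 1 : ℕ) + 1 := by
      rw [abs_le] at hh ⊢
      push_cast
      constructor <;> linarith [(Nat.cast_nonneg k : (0 : ℝ) ≤ k)]
    refine le_of_mul_le_mul_right (a := ((k + 1 : ℕ) : ℝ) + 1) ?_ (by positivity)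
    rw [h1]
    exact mul_le_mul ih h2 (abs_nonneg _) (abs_nonneg _)

/-- From log((m + 1)/m) ≥ 1/(m + 1) and e^x ≥ 1 + x; this is the induction step for
`abs_choose_neg_le_rpow`. -/
theorem rpow_mul_one_add_div_le {a m : ℝ} (ha : 0 < a) (hm : 0 < m) :
    m ^ a * (1 + a / (m + 1)) ≤ (m + 1) ^ a := by
  have h1 : 1 + a / (m + 1) ≤ ((m + 1) / m) ^ a := by
    have h2 : 1 / (m + 1) ≤ Real.log ((m + 1) / m) := by
      have := Real.one_sub_inv_le_log_of_pos (by positivity : 0 < (m + 1) / m)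
      refine le_trans (le_of_eq ?_) this
      field_simp
      ring
    rw [Real.rpow_def_of_pos (by positivity)]
    have h3 := Real.add_one_le_exp (Real.log ((m + 1) / m) * a)
    have h4 : 1 / (m + 1) * a ≤ Real.log ((m + 1) / m) * a := by gcongr
    rw [div_mul_eq_mul_div, one_mul] at h4
    linarith
  calc m ^ a * (1 + a / (m + 1)) ≤ m ^ a * ((m + 1) / m) ^ a := by gcongr
    _ = (m + 1) ^ a := by
      rw [← Real.mul_rpow hm.le (by positivity)]
      congr 1
      field_simp

/-- Passing from k to k + 1 multiplies k |binom(-a, k)| by 1 + a/k, so it grows no faster than k^a.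
The constant 2a comes from the start a(a + 1) ≤ 2a at k = 2. -/
theorem abs_choose_neg_le_rpow {a : ℝ} (ha : 0 < a) (ha1 : a < 1) {k : ℕ} (hk : 1 ≤ k) :
    |Ring.choose (-a) k| ≤ 2 * a / (k : ℝ) ^ (1 - a) := by
  have step : ∀ k : ℕ, ((k + 1 : ℕ) : ℝ) * |Ring.choose (-a) (k + 1)| =
      |Ring.choose (-a) k| * (a + k) := by
    intro k
    have h1 := congrArg abs (choose_succ_mul (-a) k)
    rw [abs_mul, abs_mul, abs_of_pos (by positivity : (0 : ℝ) < k + 1),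
      show -a - (k : ℝ) = -(a + k) by ring, abs_neg,
      abs_of_pos (by positivity : (0 : ℝ) < a + k)] at h1
    push_cast
    linarith
  have key : ∀ m : ℕ, 1 ≤ m →
      ((m + 1 : ℕ) : ℝ) * |Ring.choose (-a) (m + 1)| ≤ 2 * a * (m : ℝ) ^ a := by
    intro m hm
    induction m, hm using Nat.le_induction with
    | base =>
      rw [step]
      simp only [Ring.choose_one_right, abs_neg, abs_of_pos ha, Nat.cast_one, Real.one_rpow]
      nlinarith
    | succ m hm ih =>
      have hm0 : (0 : ℝ) < m := by exact_mod_cast hm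
      rw [step]
      have h2 := rpow_mul_one_add_div_le ha hm0
      push_cast at ih ⊢
      have h3 : |Ring.choose (-a) (m + 1)| * (a + (m + 1)) =
          (((m : ℝ) + 1) * |Ring.choose (-a) (m + 1)|) * (1 + a / (m + 1)) := by
        field_simp
        ring
      rw [h3]
      calc _ ≤ (2 * a * (m : ℝ) ^ a) * (1 + a / (m + 1)) := by gcongr
        _ = 2 * a * ((m : ℝ) ^ a * (1 + a / (m + 1))) := by ring
        _ ≤ _ := by gcongr
  have hk0 : (0 : ℝ) < k := by exact_mod_cast hk
  have h1 : (k : ℝ) * |Ring.choose (-a) k| ≤ 2 * a * (k : ℝ) ^ a := by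
    rcases Nat.lt_or_eq_of_le hk with h | h
    · obtain ⟨m, rfl⟩ := Nat.exists_eq_add_of_le' hk
      refine (key m (by omega)).trans ?_
      gcongr
      simp
    · rw [← h]
      simp [abs_of_pos ha]
      linarith
  rw [le_div_iff₀ (by positivity), Real.rpow_sub hk0, Real.rpow_one]
  rw [mul_div_assoc', div_le_iff₀ (by positivity)]
  linarith

section
variable {d : ℕ → ℝ} {l N : ℕ}

theorem abs_A_le {B : ℝ} (hB : ∀ k ∈ tuples (l + 1) l N, |binomTerm d k| ≤ B) (hB0 : 0 ≤ B) :
    |A d l N| ≤ Fintype.card (Nat.Partition l) * B := by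
  rw [A_eq_sum_tuples]
  refine (Finset.abs_sum_le_sum_abs _ _).trans ((Finset.sum_le_card_nsmul _ _ _ hB).trans ?_)
  rw [nsmul_eq_mul]
  gcongr
  exact card_tuples_le l N

theorem abs_binomTerm {M : ℕ} (k : Fin M → ℕ) :
    |binomTerm d k| = ∏ i : Fin M, |Ring.choose (-hSeq d (i + 1)) (k i)| := by
  rw [binomTerm, abs_mul, abs_pow, abs_neg, abs_one, one_pow, mul_one, Finset.abs_prod]

/-- Since i ≤ 2(i - 1) for i ≥ 2, the two equations give k_1 ≥ N - 2l. The decay comes from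
binom(-d_1, k_1) alone; the other factors are at most 1. -/
theorem abs_A_le_of_two_mul_lt (H : Admissible d) (hl : 2 * l < N) :
    |A d l N| ≤ Fintype.card (Nat.Partition l) * (2 * d 1 / ((N : ℝ) - 2 * l) ^ (1 - d 1)) := by
  have hpos : (0 : ℝ) < (N : ℝ) - 2 * l := by
    have : (2 * l : ℝ) < N := by exact_mod_cast hl
    linarith
  have hd := H.pos
  refine abs_A_le (fun k hk => ?_) (by positivity)
  have h1 : N ≤ k 0 + 2 * l := by
    rw [mem_tuples, Fin.sum_univ_succ, Fin.sum_univ_succ] at hk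
    have h2 : ∑ i : Fin l, ((i.succ : ℕ) + 1) * k i.succ ≤
        2 * ∑ i : Fin l, (i.succ : ℕ) * k i.succ := by
      rw [Finset.mul_sum]
      refine Finset.sum_le_sum fun i _ => ?_
      rw [← mul_assoc]
      refine Nat.mul_le_mul_right _ ?_
      rw [Fin.val_succ]
      omega
    simp only [Fin.val_zero, zero_add, one_mul, zero_mul] at hk
    omega
  rw [abs_binomTerm, Fin.prod_univ_succ]
  simp only [Fin.val_zero, zero_add, hSeq_one]
  have h3 : ∏ i : Fin l, |Ring.choose (-hSeq d ((i.succ : ℕ) + 1)) (k i.succ)| ≤ 1 :=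
    Finset.prod_le_one (fun _ _ => abs_nonneg _) fun i _ =>
      abs_choose_neg_le_one (abs_hSeq_le_one H (Nat.succ_ne_zero _)) _
  have h4 : (N : ℝ) - 2 * l ≤ k 0 := by
    have : (N : ℝ) ≤ k 0 + 2 * l := by exact_mod_cast h1
    linarith
  calc _ ≤ |Ring.choose (-d 1) (k 0)| * 1 := by gcongr
    _ ≤ 2 * d 1 / (k 0 : ℝ) ^ (1 - d 1) := by
      rw [mul_one]
      exact abs_choose_neg_le_rpow H.pos H.lt_one (by omega)
    _ ≤ _ := by
      gcongr
      linarith [H.lt_one]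

/-- For l close to N the entry k_1 may be 0. Some k_i is nonzero, however, and its factor is at most
|h_i| ≤ i d_1 ≤ N d_1, which still retains d_1. -/
theorem abs_A_le_mul (H : Admissible d) (hl : l < N) :
    |A d l N| ≤ Fintype.card (Nat.Partition l) * (N * d 1) := by
  have hd := H.pos
  refine abs_A_le (fun k hk => ?_) (by positivity)
  have h1 : ∃ i, k i ≠ 0 := by
    by_contra! h
    rw [mem_tuples] at hk
    have := hk.1
    simp only [h, mul_zero, Finset.sum_const_zero] at this
    omega
  obtain ⟨i, hi⟩ := h1
  obtain ⟨m, hm⟩ := Nat.exists_eq_succ_of_ne_zero hi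
  have hone : ∀ i : Fin (l + 1), |hSeq d (i + 1)| ≤ 1 := fun i =>
    abs_hSeq_le_one H (Nat.succ_ne_zero _)
  rw [abs_binomTerm, ← Finset.mul_prod_erase _ _ (Finset.mem_univ i)]
  have h3 : ∏ j ∈ univ.erase i, |Ring.choose (-hSeq d ((j : ℕ) + 1)) (k j)| ≤ 1 :=
    Finset.prod_le_one (fun _ _ => abs_nonneg _) fun j _ => abs_choose_neg_le_one (hone j) _
  have h4 : |Ring.choose (-hSeq d ((i : ℕ) + 1)) (k i)| ≤ N * d 1 := by
    rw [hm]
    refine (abs_choose_neg_le_abs (hone i) m).trans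
      ((abs_hSeq_le_mul H (Nat.succ_ne_zero _)).trans ?_)
    gcongr
    have := i.2
    omega
  calc _ ≤ (N * d 1) * 1 := mul_le_mul h4 h3 (Finset.prod_nonneg fun _ _ => abs_nonneg _)
        (by positivity)
    _ = _ := mul_one _

theorem rpow_one_sub_le {a x y c : ℝ} (ha : 0 < a) (ha1 : a < 1) (hx : 0 ≤ x) (hc : 1 ≤ c)
    (hxy : x ≤ c * y) (hy : 0 ≤ y) : x ^ (1 - a) ≤ c * y ^ (1 - a) := by
  calc x ^ (1 - a) ≤ (c * y) ^ (1 - a) := Real.rpow_le_rpow hx hxy (by linarith)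
    _ = c ^ (1 - a) * y ^ (1 - a) := Real.mul_rpow (by linarith) hy
    _ ≤ c ^ (1 : ℝ) * y ^ (1 - a) := by
      gcongr
      linarith
    _ = _ := by rw [Real.rpow_one]

theorem abs_A_le_of_le_mul {c : ℝ} (H : Admissible d) (hc : 1 ≤ c) (hl : 2 * l < N)
    (h : (N : ℝ) ≤ c * (N - 2 * l)) :
    |A d l N| ≤ 2 * c * (d 1 * Fintype.card (Nat.Partition l) / (N : ℝ) ^ (1 - d 1)) := by
  have hd := H.pos
  have hpos : (0 : ℝ) < (N : ℝ) - 2 * l := by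
    have : (2 * l : ℝ) < N := by exact_mod_cast hl
    linarith
  have hN : (0 : ℝ) < N := by
    have : 0 < N := by omega
    exact_mod_cast this
  refine (abs_A_le_of_two_mul_lt H hl).trans ?_
  have h1 := rpow_one_sub_le H.pos H.lt_one hN.le hc h hpos.le
  have h2 : 2 * d 1 / ((N : ℝ) - 2 * l) ^ (1 - d 1) ≤ 2 * d 1 * c / (N : ℝ) ^ (1 - d 1) := by
    rw [div_le_div_iff₀ (by positivity) (by positivity), mul_assoc (2 * d 1)]
    gcongr
  calc _ ≤ Fintype.card (Nat.Partition l) * (2 * d 1 * c / (N : ℝ) ^ (1 - d 1)) := by gcongr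
    _ = _ := by ring

/-- If 4l ≤ N, then N ≤ 2(N - 2l) and the main bound applies. Otherwise N ≤ 4 · 2^l, and the factor
N^2 lost by the crude bound is at most 16 · 4^l; the remaining 2^l bounds p(l). -/
theorem abs_A_le_pow (H : Admissible d) (hl : l < N) :
    |A d l N| ≤ 16 * 8 ^ l * (d 1 / (N : ℝ) ^ (1 - d 1)) := by
  have hd := H.pos
  have hN : (0 : ℝ) < N := by
    have : 0 < N := by omega
    exact_mod_cast this
  have hp : (Fintype.card (Nat.Partition l) : ℝ) ≤ 2 ^ l := by exact_mod_cast card_partition_le l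
  have h28 : (2 : ℝ) ^ l ≤ 8 ^ l := pow_le_pow_left₀ (by norm_num) (by norm_num) l
  have hW : 0 < d 1 / (N : ℝ) ^ (1 - d 1) := by positivity
  rcases le_or_gt (4 * l) N with h | h
  · have h4 : (4 * l : ℝ) ≤ N := by exact_mod_cast h
    refine (abs_A_le_of_le_mul (c := 2) H one_le_two (by omega) (by linarith)).trans ?_
    calc _ = 4 * Fintype.card (Nat.Partition l) * (d 1 / (N : ℝ) ^ (1 - d 1)) := by ring
      _ ≤ _ := by
        gcongr
        · norm_num
        · exact hp.trans h28
  · refine (abs_A_le_mul H hl).trans ?_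
    have hNl : (N : ℝ) ≤ 4 * 2 ^ l := by
      have h1 : N ≤ 4 * 2 ^ l := h.le.trans (Nat.mul_le_mul_left 4 Nat.lt_two_pow_self.le)
      exact_mod_cast h1
    have h5 : (N : ℝ) ^ (1 - d 1) ≤ N := by
      have hN1 : (1 : ℝ) ≤ N := by
        have : 1 ≤ N := by omega
        exact_mod_cast this
      calc (N : ℝ) ^ (1 - d 1) ≤ (N : ℝ) ^ (1 : ℝ) :=
            Real.rpow_le_rpow_of_exponent_le hN1 (by linarith)
        _ = N := Real.rpow_one _
    have h6 : (N : ℝ) * d 1 ≤ N * N * (d 1 / (N : ℝ) ^ (1 - d 1)) := by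
      rw [mul_div_assoc', le_div_iff₀ (by positivity)]
      calc (N : ℝ) * d 1 * (N : ℝ) ^ (1 - d 1) ≤ N * d 1 * N := by gcongr
        _ = _ := by ring
    calc _ ≤ (2 : ℝ) ^ l * ((4 * 2 ^ l) * (4 * 2 ^ l) * (d 1 / (N : ℝ) ^ (1 - d 1))) := by
          refine mul_le_mul hp (h6.trans ?_) (by positivity) (by positivity)
          gcongr
      _ = _ := by
        rw [show (8 : ℝ) = 2 * (2 * 2) by norm_num, mul_pow, mul_pow]
        ring

end

/-! ### Truncating the expansion in powers of q -/

theorem le_of_le_div_log {N h : ℕ} (hN : 190 ≤ N)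
    (hh : (h : ℝ) ≤ (N : ℝ) / (36 * Real.log N)) : 36 * h ≤ N := by
  have hN' : (190 : ℝ) ≤ N := by exact_mod_cast hN
  have h1 : 1 ≤ Real.log N := by
    rw [Real.le_log_iff_exp_le (by linarith)]
    linarith [Real.exp_one_lt_d9]
  rw [le_div_iff₀ (by positivity)] at hh
  have h2 : (36 * h : ℝ) ≤ h * (36 * Real.log N) := by
    nlinarith [(Nat.cast_nonneg h : (0 : ℝ) ≤ h)]
  have : (36 * h : ℝ) ≤ N := h2.trans hh
  exact_mod_cast this

/-- Here N - 2l ≥ (17/18) N, so the constant is 2 · 18/17. -/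
theorem abs_A_le_of_le {d : ℕ → ℝ} (H : Admissible d) {N l : ℕ} (hN : 190 ≤ N)
    (hl : 36 * l ≤ N) :
    |A d l N| ≤ 36 / 17 * (d 1 * Fintype.card (Nat.Partition l) / (N : ℝ) ^ (1 - d 1)) := by
  have h4 : (36 * l : ℝ) ≤ N := by exact_mod_cast hl
  have := abs_A_le_of_le_mul (c := 18 / 17) H (by norm_num) (show 2 * l < N by omega)
    (by linarith)
  refine this.trans (le_of_eq ?_)
  ring

/-- One factor q absorbs 8^h and the constants. Each further factor q ≥ 16 beats 8 with a gain of
1/2, which makes the tail geometric. -/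
theorem tail_term_le {q : ℝ} {h : ℕ} (hq : 4096 * 8 ^ h ≤ q) (i : ℕ) :
    16 * 8 ^ (h + 1 + i) ≤ q ^ (i + 1) * (1 / 4 * (1 / 2) ^ i) := by
  have h8 : (1 : ℝ) ≤ 8 ^ h := one_le_pow₀ (by norm_num)
  have hq0 : 0 ≤ q := by linarith
  have h1 : (16 : ℝ) ^ i ≤ q ^ i := pow_le_pow_left₀ (by norm_num) (by linarith) i
  have h2 : (16 : ℝ) ^ i * (1 / 2) ^ i = 8 ^ i := by
    rw [← mul_pow]
    norm_num
  calc (16 : ℝ) * 8 ^ (h + 1 + i) = 128 * 8 ^ h * 8 ^ i := by ring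
    _ ≤ 1024 * 8 ^ h * 8 ^ i := by gcongr; norm_num
    _ = (4096 * 8 ^ h) * 16 ^ i * (1 / 4 * (1 / 2) ^ i) := by
      rw [← h2]
      ring
    _ ≤ q * q ^ i * (1 / 4 * (1 / 2) ^ i) := by gcongr
    _ = _ := by ring

theorem abs_T_sub_sum_le {F : Type*} [Field F] [Fintype F] {g : F[X] → ℝ} {d : ℕ → ℝ}
    (H : Admissible d) (hg : IsMultiplicative g)
    (hgd : ∀ P : F[X], P.Monic → Irreducible P → ∀ k : ℕ, 1 ≤ k → g (P ^ k) = d k)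
    {N h : ℕ} (hN : 190 ≤ N) (h1 : 1 ≤ h) (hh : 36 * h ≤ N)
    (hq : (17 * h) ^ (12 * h + 9) ≤ Fintype.card F) :
    |T g N - ∑ l ∈ range h, A d l N * (Fintype.card F : ℝ) ^ (N - l)| ≤
      3.1 * (d 1 * (Fintype.card (Nat.Partition h) : ℝ) * (Fintype.card F : ℝ) ^ (N - h) /
        (N : ℝ) ^ (1 - d 1)) := by
  have hd := H.pos
  have hq' : (4096 * 8 ^ h : ℝ) ≤ Fintype.card F := by
    have : 4096 * 8 ^ h ≤ Fintype.card F := by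
      refine le_trans ?_ hq
      calc 4096 * 8 ^ h ≤ 17 ^ 9 * 17 ^ (12 * h) := by
            refine Nat.mul_le_mul (by norm_num) ((Nat.pow_le_pow_left (by norm_num) h).trans
              (Nat.pow_le_pow_right (by norm_num) (by omega)))
        _ = 17 ^ (12 * h + 9) := by rw [← pow_add, add_comm]
        _ ≤ _ := Nat.pow_le_pow_left (by omega) _
    exact_mod_cast this
  set q := (Fintype.card F : ℝ) with hqdef
  have hq0 : 0 < q := lt_of_lt_of_le (by positivity) hq'
  have hN0 : (0 : ℝ) < N := by
    have : 0 < N := by omega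
    exact_mod_cast this
  set W := d 1 / (N : ℝ) ^ (1 - d 1) with hW
  have hW0 : 0 < W := by positivity
  obtain ⟨m, rfl⟩ : ∃ m, N = h + 1 + m := Nat.exists_eq_add_of_le (by omega)
  rw [T_eq_sum_A hg hgd (by omega), Nat.card_eq_fintype_card, ← hqdef, Finset.sum_range_add,
    Finset.sum_range_succ]
  have h2 : |A d h (h + 1 + m) * q ^ (h + 1 + m - h)| ≤
      36 / 17 * (W * Fintype.card (Nat.Partition h)) * q ^ (h + 1 + m - h) := by
    rw [abs_mul, abs_of_pos (pow_pos hq0 _)]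
    gcongr
    refine (abs_A_le_of_le H hN hh).trans (le_of_eq ?_)
    rw [hW]
    ring
  have h3 : |∑ i ∈ range m, A d (h + 1 + i) (h + 1 + m) * q ^ (h + 1 + m - (h + 1 + i))| ≤
      1 / 2 * W * q ^ (h + 1 + m - h) := by
    refine (Finset.abs_sum_le_sum_abs _ _).trans ?_
    have h4 : ∀ i ∈ range m, |A d (h + 1 + i) (h + 1 + m) * q ^ (h + 1 + m - (h + 1 + i))| ≤
        1 / 4 * W * q ^ (h + 1 + m - h) * (1 / 2) ^ i := by
      intro i hi
      have him := Finset.mem_range.1 hi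
      rw [abs_mul, abs_of_pos (pow_pos hq0 _)]
      have h5 := abs_A_le_pow H (show h + 1 + i < h + 1 + m by omega)
      rw [← hW] at h5
      have h6 := tail_term_le hq' i
      rw [show h + 1 + m - h = (i + 1) + (h + 1 + m - (h + 1 + i)) by omega, pow_add]
      calc _ ≤ 16 * 8 ^ (h + 1 + i) * W * q ^ (h + 1 + m - (h + 1 + i)) := by gcongr
        _ ≤ (q ^ (i + 1) * (1 / 4 * (1 / 2) ^ i)) * W * q ^ (h + 1 + m - (h + 1 + i)) := by
          gcongr
        _ = _ := by ring
    refine (Finset.sum_le_sum h4).trans ?_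
    rw [← Finset.mul_sum]
    calc _ ≤ 1 / 4 * W * q ^ (h + 1 + m - h) * 2 := by
          gcongr
          exact sum_geometric_two_le m
      _ = _ := by ring
  have hp : (1 : ℝ) ≤ Fintype.card (Nat.Partition h) := by
    exact_mod_cast Fintype.card_pos
  have h7 : W * q ^ (h + 1 + m - h) ≤
      W * Fintype.card (Nat.Partition h) * q ^ (h + 1 + m - h) := by
    calc _ = W * 1 * q ^ (h + 1 + m - h) := by ring
      _ ≤ _ := by gcongr
  rw [show ∀ a b c : ℝ, a + b + c - a = b + c by intros; ring]
  refine (abs_add_le _ _).trans ((add_le_add h2 h3).trans ?_)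
  have h8 : d 1 * (Fintype.card (Nat.Partition h) : ℝ) * q ^ (h + 1 + m - h) /
      ((h + 1 + m : ℕ) : ℝ) ^ (1 - d 1) =
        W * Fintype.card (Nat.Partition h) * q ^ (h + 1 + m - h) := by
    rw [hW]
    ring
  rw [h8]
  -- The term l = h contributes 36/17 and the tail l > h contributes 1/2, together less than 3.1.
  have h9 : 0 < W * Fintype.card (Nat.Partition h) * q ^ (h + 1 + m - h) := by positivity
  linarith

/-! ### Exponentials of convergent power series -/

section PowerSeriesFunctions
variable {c : ℕ → ℂ} {r : ℝ}

theorem hasFPowerSeriesOnBall_tsum (hr : 0 < r)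
    (hc : ∀ x ∈ Metric.ball (0 : ℂ) r, Summable fun m => c m * x ^ m) :
    HasFPowerSeriesOnBall (fun x => ∑' m, c m * x ^ m)
      (FormalMultilinearSeries.ofScalars ℂ c) 0 (ENNReal.ofReal r) where
  r_pos := by simpa using hr
  r_le := by
    refine ENNReal.le_of_forall_nnreal_lt fun s hs => ?_
    have hs' : (s : ℝ) < r := by
      rw [← ENNReal.ofReal_coe_nnreal, ENNReal.ofReal_lt_ofReal_iff hr] at hs
      exact hs
    -- Convergence at the real point s makes the terms there tend to 0, which already bounds the
    -- radius below by s.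
    have h1 := (hc (s : ℝ) (by simpa using hs')).tendsto_atTop_zero.norm
    refine FormalMultilinearSeries.le_radius_of_tendsto _ (l := ‖(0 : ℂ)‖) (h1.congr fun m => ?_)
    rw [FormalMultilinearSeries.ofScalars_norm]
    simp
  hasSum := by
    intro y hy
    rw [Metric.eball_ofReal] at hy
    simp only [FormalMultilinearSeries.ofScalars_apply_eq, smul_eq_mul, zero_add]
    exact (hc y hy).hasSum

theorem iteratedDeriv_tsum_zero (hr : 0 < r)
    (hc : ∀ x ∈ Metric.ball (0 : ℂ) r, Summable fun m => c m * x ^ m) (m : ℕ) :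
    iteratedDeriv m (fun x => ∑' m, c m * x ^ m) 0 = m.factorial * c m := by
  have h1 := hasFPowerSeriesOnBall_tsum hr hc
  have h2 := h1.analyticAt.hasFPowerSeriesAt
  have h3 := congrArg (fun p => FormalMultilinearSeries.coeff p m)
    (h1.hasFPowerSeriesAt.eq_formalMultilinearSeries h2)
  simp only [FormalMultilinearSeries.coeff_ofScalars] at h3
  have hm : (m.factorial : ℂ) ≠ 0 := by exact_mod_cast m.factorial_ne_zero
  rw [h3, mul_div_cancel₀ _ hm]

theorem differentiableOn_tsum (hr : 0 < r)
    (hc : ∀ x ∈ Metric.ball (0 : ℂ) r, Summable fun m => c m * x ^ m) :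
    DifferentiableOn ℂ (fun x => ∑' m, c m * x ^ m) (Metric.ball 0 r) := by
  have h := (hasFPowerSeriesOnBall_tsum hr hc).differentiableOn
  rwa [Metric.eball_ofReal] at h

/-- The Taylor coefficients of the exponential of a power series. -/
theorem iteratedDeriv_cexp_tsum (hr : 0 < r)
    (hc : ∀ x ∈ Metric.ball (0 : ℂ) r, Summable fun m => c m * x ^ m) (hc0 : c 0 = 0)
    {α : ℕ → ℂ} (hα0 : α 0 = 1)
    (hα : ∀ m : ℕ, (m : ℂ) * α m =
      ∑ p ∈ HasAntidiagonal.antidiagonal m, (p.1 : ℂ) * c p.1 * α p.2) (m : ℕ) :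
    iteratedDeriv m (fun x => Complex.exp (∑' m, c m * x ^ m)) 0 = m.factorial * α m := by
  set L : ℂ → ℂ := fun x => ∑' m, c m * x ^ m with hL
  have hLd : DifferentiableOn ℂ L (Metric.ball 0 r) := differentiableOn_tsum hr hc
  have hball : Metric.ball (0 : ℂ) r ∈ nhds (0 : ℂ) := Metric.ball_mem_nhds _ hr
  have hLa : AnalyticAt ℂ L 0 := hLd.analyticAt hball
  have hGa : AnalyticAt ℂ (fun x => Complex.exp (L x)) 0 := (hLd.cexp).analyticAt hball
  induction m using Nat.strong_induction_on with
  | _ m ih =>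
    rcases m with _ | m
    · have : L 0 = 0 := by
        have := iteratedDeriv_tsum_zero hr hc 0
        simpa [hc0] using this
      change Complex.exp (L 0) = _
      rw [this, Complex.exp_zero, hα0]
      simp
    -- Leibniz's rule for G' = L' G at 0 is, after division by factorials, the recursion `hα`.
    · have hd : deriv (fun x => Complex.exp (L x)) =ᶠ[nhds 0]
          (deriv L * fun x => Complex.exp (L x)) := by
        filter_upwards [hball] with x hx
        have := (hLd.differentiableAt (Metric.isOpen_ball.mem_nhds hx))
        rw [Pi.mul_apply, deriv_cexp this, mul_comm]
      rw [iteratedDeriv_succ', hd.iteratedDeriv_eq, iteratedDeriv_mul hLa.deriv.contDiffAt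
        hGa.contDiffAt]
      have h1 : ∀ i ∈ range (m + 1), (m.choose i : ℂ) * iteratedDeriv i (deriv L) 0 *
          iteratedDeriv (m - i) (fun x => Complex.exp (L x)) 0 =
            m.factorial * (((i + 1 : ℕ) : ℂ) * c (i + 1) * α (m - i)) := by
        intro i hi
        have him : i ≤ m := Nat.lt_succ_iff.1 (Finset.mem_range.1 hi)
        rw [← iteratedDeriv_succ', iteratedDeriv_tsum_zero hr hc, ih (m - i) (by omega)]
        have h2 := congrArg (Nat.cast (R := ℂ)) (Nat.choose_mul_factorial_mul_factorial him)
        push_cast [Nat.factorial_succ] at h2 ⊢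
        rw [← h2]
        ring
      rw [Finset.sum_congr rfl h1, ← Finset.mul_sum]
      have h3 := hα (m + 1)
      rw [Finset.Nat.sum_antidiagonal_eq_sum_range_succ
        (fun i j => (i : ℂ) * c i * α j), Finset.sum_range_succ'] at h3
      simp only [Nat.cast_zero, zero_mul, add_zero, Nat.add_sub_add_right] at h3
      rw [← h3]
      push_cast [Nat.factorial_succ]
      ring

theorem hasSum_cexp_tsum (hr : 0 < r)
    (hc : ∀ x ∈ Metric.ball (0 : ℂ) r, Summable fun m => c m * x ^ m) (hc0 : c 0 = 0)
    {α : ℕ → ℂ} (hα0 : α 0 = 1)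
    (hα : ∀ m : ℕ, (m : ℂ) * α m =
      ∑ p ∈ HasAntidiagonal.antidiagonal m, (p.1 : ℂ) * c p.1 * α p.2)
    {x : ℂ} (hx : x ∈ Metric.ball (0 : ℂ) r) :
    HasSum (fun m => α m * x ^ m) (Complex.exp (∑' m, c m * x ^ m)) := by
  have h := Complex.hasSum_taylorSeries_on_ball (differentiableOn_tsum hr hc).cexp hx
  refine h.congr_fun ?_ 
  intro m
  rw [iteratedDeriv_cexp_tsum hr hc hc0 hα0 hα]
  have : (m.factorial : ℂ) ≠ 0 := by exact_mod_cast m.factorial_ne_zero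
  simp only [sub_zero, smul_eq_mul]
  field_simp

end PowerSeriesFunctions

/-! ### The Euler product a(x) -/

theorem aSeq_zero (d : ℕ → ℝ) : aSeq d 0 = 0 := by
  rw [aSeq, PowerSeries.coeff_zero_eq_constantCoeff_apply]
  exact PowerSeries.constantCoeff_logOf (by simp [genSeries])

theorem aSeq_one (d : ℕ → ℝ) : aSeq d 1 = d 1 := by
  rw [← bSeq_one d, bSeq, Nat.cast_one, one_mul]

section Euler
variable {d : ℕ → ℝ}

theorem norm_aSeq_le (H : Admissible d) (k : ℕ) : ‖(aSeq d k : ℂ)‖ ≤ 1 := by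
  rcases Nat.eq_zero_or_pos k with rfl | hk
  · simp [aSeq_zero]
  · obtain ⟨h1, h2⟩ := aSeq_pos_and_lt H hk
    rw [Complex.norm_real, Real.norm_of_nonneg h1.le]
    refine h2.le.trans ?_
    rw [div_le_one (by positivity)]
    exact_mod_cast hk

theorem summable_mul_pow {c : ℕ → ℂ} (hc : ∀ k, ‖c k‖ ≤ 1) {x : ℂ} (hx : ‖x‖ < 1) :
    Summable fun m => c m * x ^ m := by
  refine Summable.of_norm_bounded (summable_geometric_of_lt_one (norm_nonneg x) hx) fun m => ?_
  rw [norm_mul, norm_pow]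
  exact mul_le_of_le_one_left (by positivity) (hc m)

theorem genFun_eq_cexp (H : Admissible d) {x : ℂ} (hx : ‖x‖ < 1) :
    genFun d x = Complex.exp (∑' k, (aSeq d k : ℂ) * x ^ k) := by
  refine (hasSum_cexp_tsum (c := fun k => (aSeq d k : ℂ)) zero_lt_one (fun y hy =>
    summable_mul_pow (norm_aSeq_le H) (by simpa using hy)) (by simp [aSeq_zero])
    (α := fun k => ((PowerSeries.coeff k (genSeries d) : ℝ) : ℂ)) ?_ (fun m => ?_)
    (by simpa using hx)).tsum_eq
  · rw [coeff_zero_genSeries, Complex.ofReal_one]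
  · have h := congrArg (PowerSeries.coeff m) (theta_genSeries d)
    rw [coeff_theta, PowerSeries.coeff_mul] at h
    simp only [PowerSeries.coeff_mk, bSeq] at h
    exact_mod_cast h

/-- The coefficients of the logarithm of `f(t) (1 - t)^{d₁}`. -/
def logCoeff (d : ℕ → ℝ) (k : ℕ) : ℝ := aSeq d k - d 1 / k

theorem logCoeff_of_lt_two (d : ℕ → ℝ) {k : ℕ} (hk : k < 2) : logCoeff d k = 0 := by
  rcases (by omega : k = 0 ∨ k = 1) with rfl | rfl
  · simp [logCoeff, aSeq_zero]
  · simp [logCoeff, aSeq_one]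

theorem norm_logCoeff_le (H : Admissible d) (k : ℕ) : ‖(logCoeff d k : ℂ)‖ ≤ 1 := by
  rcases Nat.eq_zero_or_pos k with rfl | hk
  · simp [logCoeff_of_lt_two]
  · obtain ⟨h1, h2⟩ := aSeq_pos_and_lt H hk
    have hk' : (1 : ℝ) ≤ k := by exact_mod_cast hk
    have h3 : 1 / (k : ℝ) ≤ 1 := by
      rw [div_le_one (by positivity)]
      exact hk'
    have h4 : d 1 / k ≤ 1 / k := by
      gcongr
      exact H.lt_one.le
    have h5 : 0 < d 1 / k := div_pos H.pos (by positivity)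
    rw [Complex.norm_real, Real.norm_eq_abs, logCoeff, abs_le]
    constructor <;> linarith

/-- The principal power (1 - x)^{d_1} is exp(d_1 log(1 - x)), and the principal logarithm equals its
Taylor series in the unit disc, so no branch ambiguity arises. -/
theorem genFun_mul_eq_cexp (H : Admissible d) {x : ℂ} (hx : ‖x‖ < 1) :
    genFun d x * (1 - x) ^ (d 1 : ℂ) = Complex.exp (∑' k, (logCoeff d k : ℂ) * x ^ k) := by
  have hne : 1 - x ≠ 0 := by
    intro h
    rw [sub_eq_zero] at h
    rw [← h] at hx
    simp at hx
  have hlog := Complex.hasSum_taylorSeries_neg_log hx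
  rw [genFun_eq_cexp H hx, Complex.cpow_def_of_ne_zero hne, ← Complex.exp_add]
  congr 1
  have h1 := (summable_mul_pow (norm_aSeq_le H) hx).hasSum.sub (hlog.mul_left (d 1 : ℂ))
  rw [show Complex.log (1 - x) * (d 1 : ℂ) = -((d 1 : ℂ) * -Complex.log (1 - x)) by ring,
    ← sub_eq_add_neg, ← h1.tsum_eq]
  refine tsum_congr fun k => ?_
  rw [logCoeff]
  push_cast
  ring

theorem eulerFactor_eq_cexp (F : Type*) [Field F] (H : Admissible d) {x : ℂ} (hx : ‖x‖ < 1)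
    {l : ℕ} (hl : l ≠ 0) :
    eulerFactor F d l x =
      Complex.exp (∑' k, (primeCount F l : ℂ) * (logCoeff d k : ℂ) * x ^ (l * k)) := by
  have hxl : ‖x ^ l‖ < 1 := by
    rw [norm_pow]
    exact pow_lt_one₀ (norm_nonneg x) hx hl
  rw [eulerFactor, genFun_mul_eq_cexp H hxl, ← Complex.exp_nat_mul, ← tsum_mul_left]
  congr 1
  refine tsum_congr fun k => ?_
  rw [pow_mul]
  ring

theorem primeCount_zero (F : Type*) [Field F] [Finite F] : primeCount F 0 = 0 := by
  rw [← card_monicIrreducibles, Finset.card_eq_zero, Finset.eq_empty_iff_forall_notMem]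
  intro P hP
  rw [mem_monicIrreducibles] at hP
  exact hP.2.1.natDegree_pos.ne' hP.2.2

theorem primeCount_le (F : Type*) [Field F] [Finite F] (l : ℕ) :
    primeCount F l ≤ Nat.card F ^ l := by
  rw [← card_monicIrreducibles, ← card_monic]
  refine Finset.card_le_card fun P hP => ?_
  rw [mem_monicIrreducibles] at hP
  exact mem_monic.2 ⟨hP.1, hP.2.2⟩

/-- The coefficients of the logarithm of `a(x)`. -/
def logACoeff (F : Type*) [Field F] (d : ℕ → ℝ) (m : ℕ) : ℝ :=
  ∑ x ∈ m.divisorsAntidiagonal, (primeCount F x.1 : ℝ) * logCoeff d x.2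

variable (F : Type*) [Field F] [Fintype F]

theorem mem_ball_sqrt {x : ℂ} (hx : x ∈ Metric.ball (0 : ℂ) (1 / √(Fintype.card F : ℝ))) :
    ‖x‖ < 1 ∧ (Fintype.card F : ℝ) * ‖x‖ ^ 2 < 1 := by
  rw [mem_ball_zero_iff] at hx
  have hq : (1 : ℝ) < Fintype.card F := by exact_mod_cast Fintype.one_lt_card
  have hs : 1 < √(Fintype.card F : ℝ) := by
    rw [Real.lt_sqrt zero_le_one]
    simpa using hq
  have h1 : ‖x‖ * √(Fintype.card F : ℝ) < 1 := by
    rwa [lt_div_iff₀ (by linarith)] at hx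
  constructor
  · refine lt_of_lt_of_le hx ?_
    rw [div_le_one (by linarith)]
    exact hs.le
  · have h2 : (‖x‖ * √(Fintype.card F : ℝ)) ^ 2 < 1 :=
      pow_lt_one₀ (by positivity) h1 two_ne_zero
    rw [mul_pow, Real.sq_sqrt (by linarith)] at h2
    linarith

/-- The factor (1 - x)^{d_1} removes the term k = 1. For k ≥ 2 and l ≥ 1, |x|^{lk} ≤ (|x|^2)^l
|x|^{k-2}, and with π_q(l) ≤ q^l only q |x|^2 < 1 is needed, not q |x| < 1. -/
theorem summable_primeCount_mul_logCoeff (H : Admissible d) {x : ℂ}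
    (hx : x ∈ Metric.ball (0 : ℂ) (1 / √(Fintype.card F : ℝ))) :
    Summable fun p : ℕ × ℕ =>
      (primeCount F p.1 : ℂ) * (logCoeff d p.2 : ℂ) * x ^ (p.1 * p.2) := by
  obtain ⟨hx1, hx2⟩ := mem_ball_sqrt F hx
  have hs1 : Summable fun l : ℕ => ((Fintype.card F : ℝ) * ‖x‖ ^ 2) ^ l :=
    summable_geometric_of_lt_one (by positivity) hx2
  have hs2 : Summable fun k : ℕ => ‖x‖ ^ (k - 2) := by
    rw [← summable_nat_add_iff 2]
    simpa using summable_geometric_of_lt_one (norm_nonneg x) hx1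
  refine Summable.of_norm_bounded (hs1.mul_of_nonneg hs2 (fun _ => by positivity)
    (fun _ => by positivity)) fun p => ?_
  rcases Nat.eq_zero_or_pos p.1 with h0 | h0
  · rw [h0, primeCount_zero]
    simp only [Nat.cast_zero, zero_mul, norm_zero]
    positivity
  rcases Nat.lt_or_ge p.2 2 with h2 | h2
  · rw [logCoeff_of_lt_two d h2]
    simp only [Complex.ofReal_zero, mul_zero, zero_mul, norm_zero]
    positivity
  obtain ⟨k, hk⟩ := Nat.exists_eq_add_of_le' h2
  have hp : ((primeCount F p.1 : ℕ) : ℝ) ≤ (Fintype.card F : ℝ) ^ p.1 := by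
    have := primeCount_le F p.1
    rw [Nat.card_eq_fintype_card] at this
    exact_mod_cast this
  rw [norm_mul, norm_mul, norm_pow, Complex.norm_natCast, hk, Nat.add_sub_cancel, mul_pow,
    Nat.mul_add, pow_add, mul_comm p.1 2, pow_mul ‖x‖ 2 p.1]
  have h3 : ‖x‖ ^ (p.1 * k) ≤ ‖x‖ ^ k :=
    pow_le_pow_of_le_one (norm_nonneg x) hx1.le (Nat.le_mul_of_pos_left k h0)
  calc _ ≤ (Fintype.card F : ℝ) ^ p.1 * 1 * (‖x‖ ^ k * (‖x‖ ^ 2) ^ p.1) := by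
        gcongr
        exact norm_logCoeff_le H _
    _ = _ := by ring

theorem hasSum_logACoeff (H : Admissible d) {x : ℂ}
    (hx : x ∈ Metric.ball (0 : ℂ) (1 / √(Fintype.card F : ℝ))) :
    HasSum (fun m => (logACoeff F d m : ℂ) * x ^ m)
      (∑' p : ℕ × ℕ, (primeCount F p.1 : ℂ) * (logCoeff d p.2 : ℂ) * x ^ (p.1 * p.2)) := by
  have h := (summable_primeCount_mul_logCoeff F H hx).hasSum.tsum_fiberwise
    (fun p : ℕ × ℕ => p.1 * p.2)
  refine h.congr_fun ?_
  intro m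
  rw [_root_.tsum_subtype ((fun p : ℕ × ℕ => p.1 * p.2) ⁻¹' {m}) (fun p : ℕ × ℕ =>
      (primeCount F p.1 : ℂ) * (logCoeff d p.2 : ℂ) * x ^ (p.1 * p.2)),
    tsum_eq_sum (s := m.divisorsAntidiagonal), logACoeff]
  · push_cast
    rw [Finset.sum_mul]
    refine Finset.sum_congr rfl fun p hp => ?_
    have hp' := (Nat.mem_divisorsAntidiagonal.1 hp).1
    rw [Set.indicator_of_mem (by simpa using hp'), hp']
  · intro p hp
    rw [Nat.mem_divisorsAntidiagonal, not_and_or, not_not] at hp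
    -- The fibre over m = 0 is infinite while `Nat.divisorsAntidiagonal 0` is empty; its terms
    -- vanish because `primeCount F 0` and `logCoeff d 0` are 0.
    by_cases h1 : p.1 * p.2 = m
    · have h2 : p.1 * p.2 = 0 := by
        rcases hp with h | h
        · exact absurd h1 h
        · omega
      rw [Set.indicator_of_mem (by simpa using h1)]
      rcases Nat.mul_eq_zero.1 h2 with h | h
      · rw [h, primeCount_zero]
        simp
      · rw [h, logCoeff_of_lt_two d (by norm_num)]
        simp
    · rw [Set.indicator_of_notMem (by simpa using h1)]

theorem hasProd_eulerFactor (H : Admissible d) {x : ℂ}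
    (hx : x ∈ Metric.ball (0 : ℂ) (1 / √(Fintype.card F : ℝ))) :
    HasProd (fun l : ℕ => eulerFactor F d (l + 1) x)
      (Complex.exp (∑' m, (logACoeff F d m : ℂ) * x ^ m)) := by
  have hs := summable_primeCount_mul_logCoeff F H hx
  have h1 := hs.hasSum.prod_fiberwise (fun l => (hs.prod_factor l).hasSum)
  rw [← hasSum_nat_add_iff' 1] at h1
  simp only [Finset.range_one, Finset.sum_singleton, primeCount_zero, Nat.cast_zero, zero_mul,
    tsum_zero, sub_zero] at h1
  rw [(hasSum_logACoeff F H hx).tsum_eq]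
  refine h1.cexp.congr_fun ?_
  intro l
  rw [Function.comp_apply, eulerFactor_eq_cexp F H (mem_ball_sqrt F hx).1 (Nat.succ_ne_zero l)]

theorem aFun_eq_cexp (H : Admissible d) {x : ℂ}
    (hx : x ∈ Metric.ball (0 : ℂ) (1 / √(Fintype.card F : ℝ))) :
    aFun F d x = Complex.exp (∑' m, (logACoeff F d m : ℂ) * x ^ m) :=
  (hasProd_eulerFactor F H hx).tprod_eq

theorem radius_pos : 0 < 1 / √(Fintype.card F : ℝ) := by
  have : (0 : ℝ) < Fintype.card F := by exact_mod_cast Fintype.card_pos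
  positivity

theorem differentiableOn_aFun (H : Admissible d) :
    DifferentiableOn ℂ (aFun F d) (Metric.ball (0 : ℂ) (1 / √(Fintype.card F : ℝ))) :=
  (differentiableOn_tsum (radius_pos F)
    fun _ hx => (hasSum_logACoeff F H hx).summable).cexp.congr fun _ hx => aFun_eq_cexp F H hx

/-- The Taylor coefficients of the derivatives of `a` at `0`. -/
theorem iteratedDeriv_aFun_zero (H : Admissible d) {α : ℕ → ℂ} (hα0 : α 0 = 1)
    (hα : ∀ m : ℕ, (m : ℂ) * α m = ∑ p ∈ HasAntidiagonal.antidiagonal m,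
      (p.1 : ℂ) * (logACoeff F d p.1 : ℂ) * α p.2) (m : ℕ) :
    iteratedDeriv m (aFun F d) 0 = m.factorial * α m := by
  rw [← iteratedDeriv_cexp_tsum (radius_pos F)
    (fun _ hx => (hasSum_logACoeff F H hx).summable) (by simp [logACoeff]) hα0 hα m]
  refine Filter.EventuallyEq.iteratedDeriv_eq m ?_
  filter_upwards [Metric.ball_mem_nhds (0 : ℂ) (radius_pos F)] with x hx
  exact aFun_eq_cexp F H hx

/-- The Taylor series of the j-th derivative at 0, multiplied by x^j / j! and shifted by j. It
converges in the whole disc because the derivative is holomorphic there. -/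
theorem hasSum_iteratedDeriv_aFun (H : Admissible d) {α : ℕ → ℂ} (hα0 : α 0 = 1)
    (hα : ∀ m : ℕ, (m : ℂ) * α m = ∑ p ∈ HasAntidiagonal.antidiagonal m,
      (p.1 : ℂ) * (logACoeff F d p.1 : ℂ) * α p.2) (j : ℕ) {x : ℂ}
    (hx : x ∈ Metric.ball (0 : ℂ) (1 / √(Fintype.card F : ℝ))) :
    HasSum (fun k => (k.choose j : ℂ) * (α k * x ^ k))
      (x ^ j / j.factorial * iteratedDeriv j (aFun F d) x) := by
  have hd : DifferentiableOn ℂ (iteratedDeriv j (aFun F d))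
      (Metric.ball (0 : ℂ) (1 / √(Fintype.card F : ℝ))) := by
    rw [iteratedDeriv_eq_iterate]
    exact (((differentiableOn_aFun F H).analyticOnNhd Metric.isOpen_ball).iterated_deriv
      j).differentiableOn
  have h := (Complex.hasSum_taylorSeries_on_ball hd hx).mul_left (x ^ j / (j.factorial : ℂ))
  rw [← hasSum_nat_add_iff' j, Finset.sum_eq_zero, sub_zero]
  · refine h.congr_fun ?_
    intro m
    have h1 : iteratedDeriv m (iteratedDeriv j (aFun F d)) 0 = (m + j).factorial * α (m + j) := by
      rw [← iteratedDeriv_aFun_zero F H hα0 hα, iteratedDeriv_eq_iterate, iteratedDeriv_eq_iterate,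
        iteratedDeriv_eq_iterate, Function.iterate_add_apply]
    rw [h1]
    have h2 := congrArg (Nat.cast (R := ℂ)) (Nat.add_choose_mul_factorial_mul_factorial m j)
    push_cast at h2
    have hm : (m.factorial : ℂ) ≠ 0 := by exact_mod_cast m.factorial_ne_zero
    have hj : (j.factorial : ℂ) ≠ 0 := by exact_mod_cast j.factorial_ne_zero
    rw [← h2, ← Nat.choose_symm_add]
    simp only [sub_zero, smul_eq_mul]
    field_simp
    ring
  · intro i hi
    rw [Nat.choose_eq_zero_of_lt (Finset.mem_range.1 hi)]
    simp

end Euler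

/-! ### Growth of the Taylor coefficients of a -/

/-- The numbers `m λ_m`, where `λ_m` are the coefficients of the logarithm of `∏_{i ≥ 2} (1 - q t^i)^{-h_i}`. -/
def tailLogDeriv (d : ℕ → ℝ) (q : ℝ) (j : ℕ) : ℝ :=
  ∑ x ∈ j.divisorsAntidiagonal, if x.1 = 1 then 0 else (x.1 : ℝ) * hSeq d x.1 * q ^ x.2

theorem sum_divisorsAntidiagonal_hSeq (d : ℕ → ℝ) (q : ℝ) (j : ℕ) :
    ∑ x ∈ j.divisorsAntidiagonal, (x.1 : ℝ) * hSeq d x.1 * q ^ x.2 =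
      tailLogDeriv d q j + PowerSeries.coeff j (geomPart q 1 (d 1)) := by
  have h1 : ∀ x ∈ j.divisorsAntidiagonal, (x.1 : ℝ) * hSeq d x.1 * q ^ x.2 =
      (if x.1 = 1 then 0 else (x.1 : ℝ) * hSeq d x.1 * q ^ x.2) +
        if x.1 = 1 then d 1 * q ^ j else 0 := by
    intro x hx
    rw [Nat.mem_divisorsAntidiagonal] at hx
    split_ifs with h
    · rw [← hx.1, h, hSeq_one]
      simp
    · simp
  rw [Finset.sum_congr rfl h1, Finset.sum_add_distrib, tailLogDeriv]
  congr 1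
  rw [Nat.sum_divisorsAntidiagonal (fun a _ => if a = 1 then d 1 * q ^ j else 0),
    Finset.sum_ite_eq']
  simp [geomPart]

/-- Subtracting d_1/k from a_k removes d_1 ∑_{l ∣ m} l π_q(l) = d_1 q^m, which is exactly the part i
= 1 of ∑_{i ∣ m} i h_i q^{m/i}. This links the analytic function a with the formal product over i ≥
2. -/
theorem natCast_mul_logACoeff (F : Type*) [Field F] [Finite F] (d : ℕ → ℝ) (m : ℕ) :
    (m : ℝ) * logACoeff F d m = tailLogDeriv d (Nat.card F) m := by
  rcases Nat.eq_zero_or_pos m with rfl | hm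
  · simp [tailLogDeriv]
  have h1 := sum_divisorsAntidiagonal_hSeq d (Nat.card F) m
  rw [← sum_primeCount_mul_bSeq (F := F)] at h1
  have h2 : (m : ℝ) * logACoeff F d m =
      ∑ x ∈ m.divisorsAntidiagonal, (x.1 : ℝ) * primeCount F x.1 * bSeq d x.2 -
        d 1 * ∑ x ∈ m.divisorsAntidiagonal, (x.1 : ℝ) * primeCount F x.1 := by
    rw [logACoeff, Finset.mul_sum, Finset.mul_sum, ← Finset.sum_sub_distrib]
    refine Finset.sum_congr rfl fun x hx => ?_
    rw [Nat.mem_divisorsAntidiagonal] at hx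
    have hx2 : (x.2 : ℝ) ≠ 0 := by
      have : x.2 ≠ 0 := fun h0 => hx.2 (by rw [← hx.1, h0, mul_zero])
      exact_mod_cast this
    rw [← hx.1, logCoeff, bSeq]
    push_cast
    field_simp
  rw [h2, h1, Nat.sum_divisorsAntidiagonal (fun l _ => (l : ℝ) * primeCount F l),
    sum_divisors_primeCount hm.ne']
  simp [geomPart, hm.ne']

theorem binomPow_add (c : ℝ) (r s : ℝ) :
    binomPow c 1 (r + s) = binomPow c 1 r * binomPow c 1 s := by
  rw [binomPow, PowerSeries.binomialSeries_add,
    PowerSeries.subst_mul (hasSubst_binomPow c one_ne_zero)]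
  rfl

theorem binomPow_natCast (n : ℕ) : binomPow 1 1 (n : ℝ) = (1 - PowerSeries.X) ^ n := by
  have hs := hasSubst_binomPow 1 one_ne_zero
  rw [binomPow, PowerSeries.binomialSeries_nat, PowerSeries.subst_pow hs,
    PowerSeries.subst_add hs, PowerSeries.subst_X hs, subst_one_eq hs]
  simp [sub_eq_add_neg]

theorem binomPow_zero (c : ℝ) : binomPow c 1 0 = 1 := by
  rw [binomPow, PowerSeries.binomialSeries_zero, subst_one_eq (hasSubst_binomPow c one_ne_zero)]

theorem geomPart_neg (c : ℝ) (i : ℕ) (h : ℝ) : geomPart c i (-h) = -geomPart c i h := by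
  ext j
  simp only [geomPart, PowerSeries.coeff_mk, map_neg]
  split_ifs <;> ring

theorem coeff_binomPow_one (c r : ℝ) (m : ℕ) :
    PowerSeries.coeff m (binomPow c 1 r) = c ^ m * ((-1) ^ m * Ring.choose r m) := by
  rw [coeff_binomPow c one_ne_zero, if_pos (one_dvd _), Nat.div_one, neg_pow]
  ring

/-- The Taylor series of `a` at `0`. -/
def aSeries {F : Type*} [Field F] [Finite F] (g : F[X] → ℝ) (d : ℕ → ℝ) : ℝ⟦X⟧ :=
  PowerSeries.mk (T g) * binomPow (Nat.card F) 1 (d 1)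

section
variable {F : Type*} [Field F] [Finite F] {g : F[X] → ℝ} {d : ℕ → ℝ}

theorem mk_T_eq_aSeries_mul (g : F[X] → ℝ) (d : ℕ → ℝ) :
    PowerSeries.mk (T g) = aSeries g d * binomPow (Nat.card F) 1 (-d 1) := by
  rw [aSeries, mul_assoc, ← binomPow_add, add_neg_cancel, binomPow_zero, mul_one]

theorem theta_aSeries (hg : IsMultiplicative g)
    (hgd : ∀ P : F[X], P.Monic → Irreducible P → ∀ k : ℕ, 1 ≤ k → g (P ^ k) = d k) :
    theta (aSeries g d) = PowerSeries.mk (tailLogDeriv d (Nat.card F)) * aSeries g d := by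
  have h1 := theta_binomPow (Nat.card F) one_ne_zero (-d 1)
  rw [neg_neg, geomPart_neg] at h1
  have h2 : PowerSeries.mk (fun j => ∑ x ∈ j.divisorsAntidiagonal,
      (x.1 : ℝ) * hSeq d x.1 * (Nat.card F : ℝ) ^ x.2) =
        PowerSeries.mk (tailLogDeriv d (Nat.card F)) + geomPart (Nat.card F) 1 (d 1) := by
    ext j
    rw [map_add, PowerSeries.coeff_mk, PowerSeries.coeff_mk, sum_divisorsAntidiagonal_hSeq]
  rw [aSeries, theta_mul, theta_mk_T_of_genSeries hg hgd, h1, h2]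
  ring

theorem coeff_zero_aSeries (hg : IsMultiplicative g) : PowerSeries.coeff 0 (aSeries g d) = 1 := by
  rw [aSeries, PowerSeries.coeff_mul]
  simp [T_zero hg, coeff_binomPow_one]

theorem mul_coeff_aSeries (hg : IsMultiplicative g)
    (hgd : ∀ P : F[X], P.Monic → Irreducible P → ∀ k : ℕ, 1 ≤ k → g (P ^ k) = d k) (m : ℕ) :
    (m : ℝ) * PowerSeries.coeff m (aSeries g d) = ∑ p ∈ HasAntidiagonal.antidiagonal m,
      tailLogDeriv d (Nat.card F) p.1 * PowerSeries.coeff p.2 (aSeries g d) := by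
  have h := congrArg (PowerSeries.coeff m) (theta_aSeries hg hgd)
  rw [coeff_theta, PowerSeries.coeff_mul] at h
  simpa only [PowerSeries.coeff_mk] using h

end

theorem exists_pow_le_mul_pow (k : ℕ) {r : ℝ} (hr : 1 < r) :
    ∃ C : ℝ, 0 < C ∧ ∀ n : ℕ, (n : ℝ) ^ k ≤ C * r ^ n := by
  obtain ⟨C, hC⟩ := (tendsto_pow_const_div_const_pow_of_one_lt k hr).bddAbove_range
  refine ⟨max C 1, by positivity, fun n => ?_⟩
  have h := hC (Set.mem_range_self n)
  have hr0 : 0 < r ^ n := pow_pos (by linarith) n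
  rw [div_le_iff₀ hr0] at h
  exact h.trans (by gcongr; exact le_max_left _ _)

/-- The logarithmic derivative of `a` has coefficients of size `O(q^{j/2})`, uniformly. -/
theorem exists_abs_tailLogDeriv_le : ∃ t : ℕ, ∀ d : ℕ → ℝ, Admissible d → ∀ s : ℝ, √2 ≤ s →
    ∀ j : ℕ, |tailLogDeriv d (s ^ 2) j| ≤ (t + 1) * s ^ j := by
  obtain ⟨C, hC0, hC⟩ := exists_pow_le_mul_pow 2 (Real.lt_sqrt_of_sq_lt (by norm_num) : 1 < √2)
  -- Then t + 1 ≥ 2 + 9C, where 2 pays for i = 2 and 9C for all i ≥ 3. An integer t is wanted for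
  -- the majorant (1 - sX)^{-(t+1)}.
  refine ⟨⌈1 + 9 * C⌉₊, fun d H s hs j => ?_⟩
  have hs1 : 1 < s := lt_of_lt_of_le (Real.lt_sqrt_of_sq_lt (by norm_num)) hs
  have hs0 : 0 < s := by linarith
  rcases Nat.eq_zero_or_pos j with rfl | hj
  · simp only [tailLogDeriv, Nat.divisorsAntidiagonal_zero, Finset.sum_empty, abs_zero]
    positivity
  have hj0 : (0 : ℝ) < j := by exact_mod_cast hj
  have hterm : ∀ x ∈ j.divisorsAntidiagonal,
      |if x.1 = 1 then 0 else (x.1 : ℝ) * hSeq d x.1 * (s ^ 2) ^ x.2| ≤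
        ((if x.1 = 2 then 2 else 0) + 9 * C / j) * s ^ j := by
    intro x hx
    have hx' := Nat.mem_divisorsAntidiagonal.1 hx
    have hx0 : x.1 ≠ 0 := fun h0 => hx'.2 (by rw [← hx'.1, h0, zero_mul])
    split_ifs with h1 h2 h2
    · omega
    · rw [abs_zero]
      positivity
    · have hh := abs_hSeq_le_one H hx0
      have hj2 : 2 * x.2 = j := by rw [← hx'.1, h2]
      rw [abs_mul, abs_mul, Nat.abs_cast, abs_of_pos (by positivity : 0 < (s ^ 2) ^ x.2), ← pow_mul,
        hj2]
      have h3 : 0 ≤ 9 * C / (j : ℝ) := by positivity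
      have h4 : (x.1 : ℝ) = 2 := by rw [h2, Nat.cast_ofNat]
      gcongr
      rw [h4]
      linarith
    · have hh := abs_hSeq_le_one H hx0
      rw [abs_mul, abs_mul, Nat.abs_cast, abs_of_pos (by positivity : 0 < (s ^ 2) ^ x.2), ← pow_mul,
        zero_add, div_mul_eq_mul_div, le_div_iff₀ hj0]
      have h3 : 3 * x.2 ≤ j := by
        rw [← hx'.1]
        exact Nat.mul_le_mul_right _ (by omega)
      have h4 : x.1 ≤ j := Nat.le_of_dvd hj ⟨x.2, hx'.1.symm⟩
      obtain ⟨n, hn⟩ := Nat.exists_eq_add_of_le (show 2 * x.2 ≤ j by omega)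
      -- For i ≥ 3 the exponent 2 · (j/i) falls short of j by n ≥ j/3. The spare s^n absorbs j^2:
      -- one j bounds the weight i, the other the number of divisors.
      have h5 : j ≤ 3 * n := by omega
      have h6 : (x.1 : ℝ) * j ≤ 9 * (C * s ^ n) := by
        have h7 : (x.1 : ℝ) ≤ j := by exact_mod_cast h4
        have h8 : (j : ℝ) ≤ 3 * n := by exact_mod_cast h5
        calc (x.1 : ℝ) * j ≤ (3 * n) * (3 * n) := by
              refine mul_le_mul (h7.trans h8) h8 hj0.le (by positivity)
          _ = 9 * (n : ℝ) ^ 2 := by ring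
          _ ≤ 9 * (C * √2 ^ n) := by
            gcongr
            exact hC n
          _ ≤ _ := by gcongr
      calc (x.1 : ℝ) * |hSeq d x.1| * s ^ (2 * x.2) * j ≤ x.1 * 1 * s ^ (2 * x.2) * j := by gcongr
        _ = (x.1 * j) * s ^ (2 * x.2) := by ring
        _ ≤ 9 * (C * s ^ n) * s ^ (2 * x.2) := by gcongr
        _ = 9 * C * s ^ j := by
          rw [hn, pow_add]
          ring
  rw [tailLogDeriv]
  refine (Finset.abs_sum_le_sum_abs _ _).trans ((Finset.sum_le_sum hterm).trans ?_)
  rw [← Finset.sum_mul]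
  refine mul_le_mul_of_nonneg_right ?_ (by positivity)
  rw [Finset.sum_add_distrib, Nat.sum_divisorsAntidiagonal (fun a _ => if a = 2 then (2 : ℝ) else 0),
    Finset.sum_ite_eq', Finset.sum_const, nsmul_eq_mul]
  have h1 : (if 2 ∈ j.divisors then (2 : ℝ) else 0) ≤ 2 := by split_ifs <;> norm_num
  have h2 : ((#j.divisorsAntidiagonal : ℕ) : ℝ) * (9 * C / j) ≤ 9 * C := by
    have h3 : ((#j.divisorsAntidiagonal : ℕ) : ℝ) ≤ j := by
      rw [← Nat.map_div_right_divisors, Finset.card_map]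
      exact_mod_cast Nat.card_divisors_le_self j
    calc _ ≤ (j : ℝ) * (9 * C / j) := by gcongr
      _ = _ := by field_simp
  have h3 := Nat.le_ceil (1 + 9 * C)
  linarith

theorem sum_range_choose_mul (t m : ℕ) :
    (t + 1) * ∑ i ∈ range m, (t + i).choose t = m * (t + m).choose t := by
  induction m with
  | zero => simp
  | succ m ih =>
    have h := Nat.choose_mul_succ_eq (t + m) t
    rw [show t + m + 1 - t = m + 1 by omega] at h
    rw [Finset.sum_range_succ, mul_add, ih, ← add_assoc t m 1, mul_comm (m + 1), ← h]
    ring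

/-- A majorant argument: the bounds are the coefficients of (1 - sX)^{-(t+1)}, whose logarithmic
derivative has coefficients (t + 1) s^j, and the recursion preserves domination. -/
theorem abs_le_choose_mul_pow {u α : ℕ → ℝ} {t : ℕ} {s : ℝ} (hs : 0 ≤ s) (hu0 : u 0 = 0)
    (hu : ∀ j, |u j| ≤ (t + 1) * s ^ j) (hα0 : α 0 = 1)
    (hα : ∀ m : ℕ, (m : ℝ) * α m = ∑ p ∈ HasAntidiagonal.antidiagonal m, u p.1 * α p.2) (m : ℕ) :
    |α m| ≤ (t + m).choose t * s ^ m := by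
  induction m using Nat.strong_induction_on with
  | _ m ih =>
    rcases m with _ | m
    · simp [hα0]
    have h := congrArg abs (hα (m + 1))
    rw [Finset.Nat.sum_antidiagonal_eq_sum_range_succ (fun i j => u i * α j),
      Finset.sum_range_succ', hu0, zero_mul, add_zero, abs_mul, Nat.abs_cast] at h
    simp only [Nat.add_sub_add_right] at h
    have h1 : |∑ i ∈ range (m + 1), u (i + 1) * α (m - i)| ≤
        ∑ i ∈ range (m + 1), ((t + 1) * s ^ (m + 1)) * ((t + (m - i)).choose t : ℝ) := by
      refine (Finset.abs_sum_le_sum_abs _ _).trans (Finset.sum_le_sum fun i hi => ?_)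
      have him : i ≤ m := Nat.lt_succ_iff.1 (Finset.mem_range.1 hi)
      rw [abs_mul]
      calc |u (i + 1)| * |α (m - i)| ≤
            ((t + 1) * s ^ (i + 1)) * ((t + (m - i)).choose t * s ^ (m - i)) :=
            mul_le_mul (hu _) (ih (m - i) (by omega)) (abs_nonneg _) (by positivity)
        _ = ((t + 1) * (s ^ (i + 1) * s ^ (m - i))) * ((t + (m - i)).choose t : ℝ) := by ring
        _ = _ := by rw [← pow_add, show i + 1 + (m - i) = m + 1 by omega]
    have h2 := Finset.sum_range_reflect (fun i => ((t + i).choose t : ℝ)) (m + 1)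
    simp only [Nat.add_sub_cancel] at h2
    rw [← Finset.mul_sum, h2] at h1
    have h4 := congrArg (Nat.cast (R := ℝ)) (sum_range_choose_mul t (m + 1))
    push_cast at h4 h
    refine le_of_mul_le_mul_left (a := (m : ℝ) + 1) ?_ (by positivity)
    rw [h]
    refine h1.trans (le_of_eq ?_)
    rw [mul_right_comm, h4]
    ring

/-- The coefficients of `a` are `O(q^{m/2})` up to a power of `m`, uniformly. -/
theorem exists_abs_coeff_aSeries_le : ∃ (K : ℝ) (t : ℕ), 0 < K ∧
    ∀ (d : ℕ → ℝ), Admissible d → ∀ (F : Type*) [Field F] [Finite F] (g : F[X] → ℝ),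
      IsMultiplicative g →
      (∀ P : F[X], P.Monic → Irreducible P → ∀ k : ℕ, 1 ≤ k → g (P ^ k) = d k) → ∀ m : ℕ,
      |PowerSeries.coeff m (aSeries g d)| ≤ K * ((m : ℝ) + 1) ^ t * √(Nat.card F) ^ m := by
  obtain ⟨t, ht⟩ := exists_abs_tailLogDeriv_le
  refine ⟨((t : ℝ) + 1) ^ t, t, by positivity, fun d H F _ _ g hg hgd m => ?_⟩
  have hq : (2 : ℝ) ≤ Nat.card F := by exact_mod_cast Finite.one_lt_card (α := F)
  have h1 := ht d H (√(Nat.card F)) (Real.sqrt_le_sqrt hq)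
  rw [Real.sq_sqrt (by linarith)] at h1
  refine (abs_le_choose_mul_pow (Real.sqrt_nonneg _) (by simp [tailLogDeriv]) h1
    (coeff_zero_aSeries hg) (mul_coeff_aSeries hg hgd) m).trans ?_
  gcongr
  have h2 : (t + m).choose t ≤ ((t + 1) * (m + 1)) ^ t :=
    (Nat.choose_le_pow _ _).trans (Nat.pow_le_pow_left (by nlinarith) t)
  rw [← mul_pow]
  exact_mod_cast h2

/-! ### Taylor expansion of w^k about w = 1 -/

theorem choose_add_one_mul (r : ℝ) (N : ℕ) :
    Ring.choose (r + 1) N * (r + 1 - N) = (r + 1) * Ring.choose r N := by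
  cases N with
  | zero => simp
  | succ M =>
    have h := choose_succ_mul r M
    rw [Ring.choose_succ_succ]
    push_cast
    linear_combination -h

theorem choose_pos_of_lt {x : ℝ} {j : ℕ} (h : (j : ℝ) - 1 < x) : 0 < Ring.choose x j := by
  induction j with
  | zero => simp
  | succ j ih =>
    push_cast at h
    have h1 := choose_succ_mul x j
    have h2 : 0 < Ring.choose x j * (x - j) := mul_pos (ih (by linarith)) (by linarith)
    rw [← h1] at h2
    exact pos_of_mul_pos_left h2 (by positivity)

/-- Converts the coefficients of (1 - w)^{j - a}, which the Taylor expansion produces, into the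
quotients of binomial coefficients in the main term. The conditions a > 0 and j ≤ N keep the
denominators positive. -/
theorem neg_one_pow_mul_choose {a : ℝ} (ha : 0 < a) {N j : ℕ} (hj : j ≤ N) :
    (-1) ^ j * Ring.choose ((j : ℝ) - a) N =
      Ring.choose (-a) N * (Ring.choose ((j : ℝ) - a) j / Ring.choose ((N : ℝ) + a - 1) j) := by
  induction j with
  | zero => simp
  | succ j ih =>
    have hN : (j : ℝ) + 1 ≤ N := by exact_mod_cast hj
    have h1 := choose_add_one_mul ((j : ℝ) - a) N
    have h2 := choose_succ_mul ((j : ℝ) - a + 1) j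
    rw [choose_add_one_mul ((j : ℝ) - a) j] at h2
    have h3 := choose_succ_mul ((N : ℝ) + a - 1) j
    have hp : 0 < Ring.choose ((N : ℝ) + a - 1) j := choose_pos_of_lt (by linarith)
    have hp' : 0 < Ring.choose ((N : ℝ) + a - 1) (j + 1) :=
      choose_pos_of_lt (by push_cast; linarith)
    have ih' := ih (by omega)
    rw [mul_div_assoc', eq_div_iff hp.ne'] at ih'
    rw [mul_div_assoc', eq_div_iff hp'.ne']
    push_cast
    rw [show (j : ℝ) + 1 - a = j - a + 1 by ring]
    have hj0 : ((j : ℝ) + 1) ≠ 0 := by positivity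
    have hne : (N : ℝ) + a - 1 - j ≠ 0 := by linarith
    apply mul_left_cancel₀ hj0
    apply mul_left_cancel₀ hne
    calc _ = (-1) ^ j * (Ring.choose ((j : ℝ) - a + 1) N * (j - a + 1 - N)) *
          (Ring.choose ((N : ℝ) + a - 1) (j + 1) * ((j : ℝ) + 1)) := by ring
      _ = ((-1) ^ j * Ring.choose ((j : ℝ) - a) N * Ring.choose ((N : ℝ) + a - 1) j) *
          (((j : ℝ) - a + 1) * ((N : ℝ) + a - 1 - j)) := by
        rw [h1, h3]
        ring
      _ = _ := by
        rw [ih']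
        linear_combination -(Ring.choose (-a) N * ((N : ℝ) + a - 1 - j)) * h2

theorem one_add_mul_sum_choose {R : Type*} [CommRing R] (Y : R) (k n : ℕ) :
    (Y + 1) * ∑ j ∈ range (n + 1), (k.choose j : R) * Y ^ j =
      ∑ j ∈ range (n + 1), ((k + 1).choose j : R) * Y ^ j + k.choose n * Y ^ (n + 1) := by
  induction n with
  | zero => simp [add_comm]
  | succ n ih =>
    rw [Finset.sum_range_succ, mul_add, ih, Finset.sum_range_succ _ (n + 1),
      Nat.choose_succ_succ' k n]
    push_cast
    ring

/-- Taylor's formula for the monomial `X^k` at `1`, with an explicit remainder. -/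
theorem pow_sub_sum_choose {R : Type*} [CommRing R] (X : R) (k n : ℕ) :
    X ^ k - ∑ j ∈ range (n + 1), (k.choose j : R) * (X - 1) ^ j =
      (X - 1) ^ (n + 1) * ∑ i ∈ range k, (i.choose n : R) * X ^ (k - 1 - i) := by
  induction k with
  | zero =>
    rw [Finset.sum_range_succ']
    simp
  | succ k ih =>
    have h1 := one_add_mul_sum_choose (X - 1) k n
    rw [sub_add_cancel] at h1
    have h2 : ∑ i ∈ range (k + 1), (i.choose n : R) * X ^ (k + 1 - 1 - i) =
        X * (∑ i ∈ range k, (i.choose n : R) * X ^ (k - 1 - i)) + k.choose n := by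
      rw [Finset.sum_range_succ, Finset.mul_sum]
      congr 1
      · refine Finset.sum_congr rfl fun i hi => ?_
        rw [show k + 1 - 1 - i = (k - 1 - i) + 1 by have := Finset.mem_range.1 hi; omega, pow_succ]
        ring
      · simp
    rw [h2, mul_add, mul_left_comm, ← ih, mul_sub, h1]
    ring

/-- The coefficient of `w^M` in `(1 - w)^r`. -/
def oneSubCoeff (r : ℝ) (M : ℕ) : ℝ := (-1) ^ M * Ring.choose r M

theorem coeff_binomPow_one_one (r : ℝ) (M : ℕ) :
    PowerSeries.coeff M (binomPow 1 1 r) = oneSubCoeff r M := by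
  rw [coeff_binomPow_one, one_pow, one_mul, oneSubCoeff]

/-- The coefficient of `w^N` in `(1 - w)^{-a} (w^k - ∑_{j ≤ n} binom(k, j) (w - 1)^j)`. -/
def taylorDefect (a : ℝ) (n N k : ℕ) : ℝ :=
  (if k ≤ N then oneSubCoeff (-a) (N - k) else 0) -
    ∑ j ∈ range (n + 1), (k.choose j : ℝ) * ((-1) ^ j * oneSubCoeff (j - a) N)

/-- Multiply Taylor's formula for w^k by (1 - w)^{-a}: the factor (w - 1)^{n+1} of the remainder
merges into (1 - w)^{n+1-a}, whose coefficients decay faster. -/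
theorem taylorDefect_eq_sum (a : ℝ) (n N k : ℕ) :
    taylorDefect a n N k = (-1) ^ (n + 1) * ∑ i ∈ range k, (i.choose n : ℝ) *
      (if k - 1 - i ≤ N then oneSubCoeff ((n + 1 : ℕ) - a) (N - (k - 1 - i)) else 0) := by
  have hpow : ∀ j : ℕ, (PowerSeries.X - 1 : ℝ⟦X⟧) ^ j * binomPow 1 1 (-a) =
      PowerSeries.C ((-1) ^ j) * binomPow 1 1 (j - a) := by
    intro j
    rw [sub_eq_add_neg (j : ℝ), binomPow_add, binomPow_natCast, ← neg_sub, neg_pow, mul_assoc]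
    simp
  have h := congrArg (fun f => PowerSeries.coeff N (f * binomPow 1 1 (-a)))
    (pow_sub_sum_choose (PowerSeries.X : ℝ⟦X⟧) k n)
  simp only [sub_mul, Finset.sum_mul, map_sub, map_sum] at h
  rw [PowerSeries.coeff_X_pow_mul', coeff_binomPow_one_one] at h
  have h1 : ∀ j ∈ range (n + 1), PowerSeries.coeff N
      ((k.choose j : ℝ⟦X⟧) * (PowerSeries.X - 1) ^ j * binomPow 1 1 (-a)) =
        (k.choose j : ℝ) * ((-1) ^ j * oneSubCoeff (j - a) N) := by
    intro j _
    rw [mul_assoc, hpow, ← map_natCast (PowerSeries.C (R := ℝ)), PowerSeries.coeff_C_mul,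
      PowerSeries.coeff_C_mul, coeff_binomPow_one_one]
  have h2 : (PowerSeries.X - 1 : ℝ⟦X⟧) ^ (n + 1) *
      (∑ i ∈ range k, (i.choose n : ℝ⟦X⟧) * PowerSeries.X ^ (k - 1 - i)) * binomPow 1 1 (-a) =
      PowerSeries.C ((-1) ^ (n + 1)) * ∑ i ∈ range k, PowerSeries.C (i.choose n : ℝ) *
        (PowerSeries.X ^ (k - 1 - i) * binomPow 1 1 ((n + 1 : ℕ) - a)) := by
    rw [mul_right_comm, hpow, mul_assoc, Finset.mul_sum]
    congr 1
    refine Finset.sum_congr rfl fun i _ => ?_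
    rw [map_natCast]
    ring
  rw [Finset.sum_congr rfl h1, h2, PowerSeries.coeff_C_mul, map_sum] at h
  rw [taylorDefect, h]
  congr 1
  refine Finset.sum_congr rfl fun i _ => ?_
  rw [PowerSeries.coeff_C_mul, PowerSeries.coeff_X_pow_mul', coeff_binomPow_one_one]

theorem taylorDefect_of_le (a : ℝ) {n N k : ℕ} (hk : k ≤ n) : taylorDefect a n N k = 0 := by
  rw [taylorDefect_eq_sum, Finset.sum_eq_zero, mul_zero]
  intro i hi
  rw [Nat.choose_eq_zero_of_lt ((Finset.mem_range.1 hi).trans_le hk)]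
  simp

/-- Put p = n + 2 - a. For M ≥ n + 1 consecutive coefficients have ratio 1 - p/(M + 1) ≤
e^{-p/(M+1)} in absolute value, while the weight grows by at most e^{p/(M+1)}, so the product does
not increase. Up to M = n + 1 a crude bound uniform in a is enough. -/
theorem exists_abs_oneSubCoeff_le (n : ℕ) : ∃ K : ℝ, 0 < K ∧ ∀ a : ℝ, 0 < a → a < 1 → ∀ M : ℕ,
    |oneSubCoeff ((n + 1 : ℕ) - a) M| * ((M : ℝ) + 1) ^ ((n : ℝ) + 2 - a) ≤ K := by
  refine ⟨((n : ℝ) + 1) ^ (n + 1) * ((n : ℝ) + 2) ^ ((n : ℝ) + 2), by positivity,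
    fun a ha ha1 M => ?_⟩
  rw [oneSubCoeff, abs_mul, abs_pow, abs_neg, abs_one, one_pow, one_mul]
  push_cast
  set s : ℝ := (n : ℝ) + 1 - a with hs
  have hn0 : (0 : ℝ) ≤ n := Nat.cast_nonneg n
  have step : ∀ M : ℕ, |Ring.choose s (M + 1)| * ((M : ℝ) + 1) = |Ring.choose s M| * |s - M| := by
    intro M
    have h1 := congrArg abs (choose_succ_mul s M)
    rwa [abs_mul, abs_mul, abs_of_pos (by positivity : (0 : ℝ) < M + 1)] at h1
  have hcrude : ∀ M : ℕ, M ≤ n + 1 → |Ring.choose s M| ≤ ((n : ℝ) + 1) ^ M := by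
    intro M hM
    induction M with
    | zero => simp
    | succ M ih =>
      have hM' : (M : ℝ) ≤ n := by exact_mod_cast (by omega : M ≤ n)
      have hM0 : (0 : ℝ) ≤ M := Nat.cast_nonneg M
      have h2 : |s - M| ≤ (n : ℝ) + 1 := by
        rw [abs_le]
        constructor <;> linarith
      calc |Ring.choose s (M + 1)| ≤ |Ring.choose s (M + 1)| * ((M : ℝ) + 1) :=
            le_mul_of_one_le_right (abs_nonneg _) (by linarith)
        _ = |Ring.choose s M| * |s - M| := step M
        _ ≤ ((n : ℝ) + 1) ^ M * (n + 1) :=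
            mul_le_mul (ih (by omega)) h2 (abs_nonneg _) (by positivity)
        _ = _ := by ring
  have hbase : ∀ M : ℕ, M ≤ n + 1 → |Ring.choose s M| * ((M : ℝ) + 1) ^ ((n : ℝ) + 2 - a) ≤
      ((n : ℝ) + 1) ^ (n + 1) * ((n : ℝ) + 2) ^ ((n : ℝ) + 2) := by
    intro M hM
    have hM' : (M : ℝ) ≤ n + 1 := by exact_mod_cast hM
    refine mul_le_mul ((hcrude M hM).trans (pow_le_pow_right₀ (by linarith) hM)) ?_
      (by positivity) (by positivity)
    calc ((M : ℝ) + 1) ^ ((n : ℝ) + 2 - a) ≤ ((n : ℝ) + 2) ^ ((n : ℝ) + 2 - a) :=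
          Real.rpow_le_rpow (by positivity) (by linarith) (by linarith)
      _ ≤ _ := Real.rpow_le_rpow_of_exponent_le (by linarith) (by linarith)
  rcases le_total M (n + 1) with hM | hM
  · exact hbase M hM
  · induction M, hM using Nat.le_induction with
    | base => exact hbase _ le_rfl
    | succ M hM ih =>
      refine le_trans ?_ ih
      have hM' : (n : ℝ) + 1 ≤ M := by exact_mod_cast hM
      set p : ℝ := (n : ℝ) + 2 - a with hp
      have hp0 : 0 < p := by linarith
      have hM0 : (0 : ℝ) < M + 1 := by linarith
      have h1 : |Ring.choose s (M + 1)| = |Ring.choose s M| * (1 - p / (M + 1)) := by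
        have h2 := step M
        rw [abs_of_nonpos (by linarith : s - (M : ℝ) ≤ 0)] at h2
        rw [eq_div_of_mul_eq hM0.ne' h2, hs, hp]
        field_simp
        ring
      have h3 : ((M + 1 : ℕ) + 1 : ℝ) ^ p * (1 - p / (M + 1)) ≤ ((M : ℝ) + 1) ^ p := by
        have h4 : ((M + 1 : ℕ) + 1 : ℝ) = (M + 1) * (1 + 1 / (M + 1)) := by
          push_cast
          field_simp
        have h5 : (1 + 1 / ((M : ℝ) + 1)) ^ p ≤ Real.exp (p / (M + 1)) := by
          have h6 := Real.add_one_le_exp (1 / ((M : ℝ) + 1))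
          calc (1 + 1 / ((M : ℝ) + 1)) ^ p ≤ (Real.exp (1 / ((M : ℝ) + 1))) ^ p :=
                Real.rpow_le_rpow (by positivity) (by linarith) hp0.le
            _ = _ := by
              rw [← Real.exp_mul]
              congr 1
              ring
        have h7 := Real.one_sub_le_exp_neg (p / ((M : ℝ) + 1))
        have h8 : (1 + 1 / ((M : ℝ) + 1)) ^ p * (1 - p / (M + 1)) ≤ 1 := by
          calc _ ≤ (1 + 1 / ((M : ℝ) + 1)) ^ p * Real.exp (-(p / (M + 1))) := by gcongr
            _ ≤ Real.exp (p / (M + 1)) * Real.exp (-(p / (M + 1))) := by gcongr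
            _ = 1 := by rw [← Real.exp_add, add_neg_cancel, Real.exp_zero]
        rw [h4, Real.mul_rpow (by positivity) (by positivity), mul_assoc]
        exact mul_le_of_le_one_right (by positivity) h8
      rw [h1, mul_assoc, mul_comm (1 - p / ((M : ℝ) + 1))]
      exact mul_le_mul_of_nonneg_left h3 (abs_nonneg _)

theorem exists_abs_taylorDefect_le (n : ℕ) : ∃ K : ℝ, 0 < K ∧ ∀ a : ℝ, 0 < a → a < 1 →
    ∀ N : ℕ, 1 ≤ N → ∀ k : ℕ, |taylorDefect a n N k| ≤
      K * ((k : ℝ) + 1) ^ (2 * n + 3) / ((N : ℝ) ^ (1 - a) * (N : ℝ) ^ (n + 1)) := by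
  obtain ⟨K, hK0, hK⟩ := exists_abs_oneSubCoeff_le n
  refine ⟨K, hK0, fun a ha ha1 N hN k => ?_⟩
  have hN0 : (0 : ℝ) < N := by exact_mod_cast hN
  have hn0 : (0 : ℝ) ≤ n := Nat.cast_nonneg n
  have hk1 : (1 : ℝ) ≤ k + 1 := by linarith [(Nat.cast_nonneg k : (0 : ℝ) ≤ k)]
  have hNp : (N : ℝ) ^ (1 - a) * (N : ℝ) ^ (n + 1) = (N : ℝ) ^ ((n : ℝ) + 2 - a) := by
    rw [← Real.rpow_natCast, ← Real.rpow_add hN0]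
    congr 1
    push_cast
    ring
  rw [hNp]
  set p : ℝ := (n : ℝ) + 2 - a with hp
  have hp0 : 0 < p := by linarith
  have hcoef : ∀ m ≤ k, m ≤ N → |oneSubCoeff ((n + 1 : ℕ) - a) (N - m)| ≤
      K * ((k : ℝ) + 1) ^ (n + 2) / (N : ℝ) ^ p := by
    intro m hmk hmN
    have h1 := hK a ha ha1 (N - m)
    -- Replacing N - m by N costs only a power of k + 1, which is harmless against the later factor
    -- q^{-k/2}.
    have h2 : (N : ℝ) ≤ (((N - m : ℕ) : ℝ) + 1) * (k + 1) := by
      have h3 : N ≤ (N - m + 1) * (k + 1) := by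
        have : N ≤ (N - m) + k := by omega
        nlinarith
      exact_mod_cast h3
    have h4 : (N : ℝ) ^ p ≤ (((N - m : ℕ) : ℝ) + 1) ^ p * ((k : ℝ) + 1) ^ (n + 2) := by
      calc (N : ℝ) ^ p ≤ ((((N - m : ℕ) : ℝ) + 1) * (k + 1)) ^ p :=
            Real.rpow_le_rpow hN0.le h2 hp0.le
        _ = (((N - m : ℕ) : ℝ) + 1) ^ p * ((k : ℝ) + 1) ^ p :=
            Real.mul_rpow (by positivity) (by positivity)
        _ ≤ _ := by
          gcongr
          rw [← Real.rpow_natCast]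
          refine Real.rpow_le_rpow_of_exponent_le hk1 ?_
          push_cast
          linarith
    rw [le_div_iff₀ (by positivity)]
    calc _ ≤ |oneSubCoeff ((n + 1 : ℕ) - a) (N - m)| *
          ((((N - m : ℕ) : ℝ) + 1) ^ p * ((k : ℝ) + 1) ^ (n + 2)) := by gcongr
      _ = (|oneSubCoeff ((n + 1 : ℕ) - a) (N - m)| * (((N - m : ℕ) : ℝ) + 1) ^ p) *
          ((k : ℝ) + 1) ^ (n + 2) := by ring
      _ ≤ _ := by gcongr
  rw [taylorDefect_eq_sum, abs_mul, abs_pow, abs_neg, abs_one, one_pow, one_mul]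
  have hterm : ∀ i ∈ range k, |(i.choose n : ℝ) *
      (if k - 1 - i ≤ N then oneSubCoeff ((n + 1 : ℕ) - a) (N - (k - 1 - i)) else 0)| ≤
        ((k : ℝ) + 1) ^ n * (K * ((k : ℝ) + 1) ^ (n + 2) / (N : ℝ) ^ p) := by
    intro i hi
    rw [abs_mul, Nat.abs_cast]
    have h1 : (i.choose n : ℝ) ≤ ((k : ℝ) + 1) ^ n := by
      have h2 : i.choose n ≤ (k + 1) ^ n := (Nat.choose_le_pow _ _).trans
        (Nat.pow_le_pow_left (by have := Finset.mem_range.1 hi; omega) n)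
      exact_mod_cast h2
    refine mul_le_mul h1 ?_ (abs_nonneg _) (by positivity)
    split_ifs with h
    · exact hcoef _ (by omega) h
    · rw [abs_zero]
      positivity
  refine (Finset.abs_sum_le_sum_abs _ _).trans ((Finset.sum_le_card_nsmul _ _ _ hterm).trans ?_)
  rw [Finset.card_range, nsmul_eq_mul]
  calc _ ≤ ((k : ℝ) + 1) * (((k : ℝ) + 1) ^ n * (K * ((k : ℝ) + 1) ^ (n + 2) / (N : ℝ) ^ p)) := by
        gcongr
        linarith
    _ = _ := by ring

/-! ### The expansion of T(N) with remainder -/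

section
variable {F : Type*} [Field F] [Fintype F] {g : F[X] → ℝ} {d : ℕ → ℝ}

theorem T_eq_sum_aSeries (g : F[X] → ℝ) (d : ℕ → ℝ) (N : ℕ) :
    T g N = (Fintype.card F : ℝ) ^ N * ∑ k ∈ range (N + 1),
      oneSubCoeff (-d 1) (N - k) *
        (PowerSeries.coeff k (aSeries g d) * (Fintype.card F : ℝ)⁻¹ ^ k) := by
  have hq : (Fintype.card F : ℝ) ≠ 0 := by exact_mod_cast Fintype.card_ne_zero
  have h := congrArg (PowerSeries.coeff N) (mk_T_eq_aSeries_mul g d)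
  rw [PowerSeries.coeff_mk, PowerSeries.coeff_mul, Nat.card_eq_fintype_card,
    Finset.Nat.sum_antidiagonal_eq_sum_range_succ (fun i j => PowerSeries.coeff i (aSeries g d) *
      PowerSeries.coeff j (binomPow (Fintype.card F) 1 (-d 1)))] at h
  rw [h, Finset.mul_sum]
  refine Finset.sum_congr rfl fun k hk => ?_
  have hkN : k ≤ N := Nat.lt_succ_iff.1 (Finset.mem_range.1 hk)
  rw [coeff_binomPow_one, ← oneSubCoeff, inv_pow]
  obtain ⟨m, rfl⟩ := Nat.exists_eq_add_of_le hkN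
  rw [Nat.add_sub_cancel_left, pow_add]
  field_simp

theorem inv_card_mem_ball (F : Type*) [Field F] [Fintype F] :
    (Fintype.card F : ℂ)⁻¹ ∈ Metric.ball (0 : ℂ) (1 / √(Fintype.card F : ℝ)) := by
  have hq : (1 : ℝ) < Fintype.card F := by exact_mod_cast Fintype.one_lt_card
  rw [mem_ball_zero_iff, norm_inv, Complex.norm_natCast, ← one_div]
  refine one_div_lt_one_div_of_lt (by positivity) ?_
  rw [Real.sqrt_lt' (by linarith)]
  nlinarith

theorem mul_ofReal_coeff_aSeries (hg : IsMultiplicative g)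
    (hgd : ∀ P : F[X], P.Monic → Irreducible P → ∀ k : ℕ, 1 ≤ k → g (P ^ k) = d k) (m : ℕ) :
    (m : ℂ) * ((PowerSeries.coeff m (aSeries g d) : ℝ) : ℂ) =
      ∑ p ∈ HasAntidiagonal.antidiagonal m, (p.1 : ℂ) * (logACoeff F d p.1 : ℂ) *
        ((PowerSeries.coeff p.2 (aSeries g d) : ℝ) : ℂ) := by
  have h := mul_coeff_aSeries hg hgd m
  simp only [← natCast_mul_logACoeff] at h
  exact_mod_cast h

/-- The main term in the expansion of `T(N)`, in terms of the coefficients of `(1 - w)^{j - d₁}`. -/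
theorem mainTerm_eq {N n : ℕ} (h0 : 0 < d 1) (hn : n + 1 ≤ N) (a : ℂ → ℂ) (w Q : ℂ) :
    (((-1) ^ N * Ring.choose (-d 1) N : ℝ) : ℂ) * Q *
      (a w + ∑ k ∈ Icc 1 n, ((Ring.choose ((k : ℝ) - d 1) k
        / Ring.choose ((N : ℝ) + d 1 - 1) k : ℝ) : ℂ) *
          (w ^ k / (k.factorial : ℂ)) * iteratedDeriv k a w) =
      Q * ∑ j ∈ range (n + 1), (((-1) ^ j * oneSubCoeff (j - d 1) N : ℝ) : ℂ) *
        (w ^ j / (j.factorial : ℂ) * iteratedDeriv j a w) := by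
  have h1 : ∑ k ∈ Icc 1 n, ((Ring.choose ((k : ℝ) - d 1) k
        / Ring.choose ((N : ℝ) + d 1 - 1) k : ℝ) : ℂ) *
          (w ^ k / (k.factorial : ℂ)) * iteratedDeriv k a w =
      ∑ i ∈ range n, ((Ring.choose (((i + 1 : ℕ) : ℝ) - d 1) (i + 1)
        / Ring.choose ((N : ℝ) + d 1 - 1) (i + 1) : ℝ) : ℂ) *
          (w ^ (i + 1) / ((i + 1).factorial : ℂ)) * iteratedDeriv (i + 1) a w := by
    rw [show Icc 1 n = Ico 1 (n + 1) by ext; simp, Finset.sum_Ico_eq_sum_range,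
      Nat.add_sub_cancel]
    simp only [add_comm 1]
  rw [h1, Finset.sum_range_succ', mul_add, mul_add, Finset.mul_sum, Finset.mul_sum]
  rw [add_comm]
  congr 1
  · refine Finset.sum_congr rfl fun i hi => ?_
    have hiN : i + 1 ≤ N := by
      have := Finset.mem_range.1 hi
      omega
    have h2 : (-1 : ℝ) ^ (i + 1) * oneSubCoeff ((i + 1 : ℕ) - d 1) N =
        (-1) ^ N * Ring.choose (-d 1) N * (Ring.choose (((i + 1 : ℕ) : ℝ) - d 1) (i + 1)
          / Ring.choose ((N : ℝ) + d 1 - 1) (i + 1)) := by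
      rw [oneSubCoeff, mul_left_comm, neg_one_pow_mul_choose h0 hiN, mul_assoc]
    rw [h2]
    push_cast
    ring
  · simp only [oneSubCoeff, pow_zero, Nat.cast_zero, zero_sub, one_mul, Nat.factorial_zero,
      Nat.cast_one, div_one, iteratedDeriv_zero]
    ring

/-- The remainder in the expansion of `T(N)` as a series. -/
theorem hasSum_taylorDefect (H : Admissible d) (hg : IsMultiplicative g)
    (hgd : ∀ P : F[X], P.Monic → Irreducible P → ∀ k : ℕ, 1 ≤ k → g (P ^ k) = d k) (N n : ℕ) :
    HasSum (fun k => ((taylorDefect (d 1) n N k *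
        (PowerSeries.coeff k (aSeries g d) * (Fintype.card F : ℝ)⁻¹ ^ k) : ℝ) : ℂ))
      ((∑ k ∈ range (N + 1), oneSubCoeff (-d 1) (N - k) *
        (PowerSeries.coeff k (aSeries g d) * (Fintype.card F : ℝ)⁻¹ ^ k) : ℝ) -
        ∑ j ∈ range (n + 1), (((-1) ^ j * oneSubCoeff (j - d 1) N : ℝ) : ℂ) *
          ((Fintype.card F : ℂ)⁻¹ ^ j / (j.factorial : ℂ) *
            iteratedDeriv j (aFun F d) (Fintype.card F : ℂ)⁻¹)) := by
  set β : ℕ → ℝ := fun k => PowerSeries.coeff k (aSeries g d) * (Fintype.card F : ℝ)⁻¹ ^ k with hβ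
  -- T(N) involves only k ≤ N but the derivatives of a involve all k; padding with zeros allows
  -- termwise subtraction.
  have h1 : HasSum (fun k => (((if k ≤ N then oneSubCoeff (-d 1) (N - k) else 0) * β k : ℝ) : ℂ))
      ((∑ k ∈ range (N + 1), oneSubCoeff (-d 1) (N - k) * β k : ℝ) : ℂ) := by
    have h2 : ∑ k ∈ range (N + 1), oneSubCoeff (-d 1) (N - k) * β k =
        ∑ k ∈ range (N + 1), (if k ≤ N then oneSubCoeff (-d 1) (N - k) else 0) * β k := by
      refine Finset.sum_congr rfl fun k hk => ?_
      rw [if_pos (Nat.lt_succ_iff.1 (Finset.mem_range.1 hk))]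
    rw [h2, Complex.ofReal_sum]
    refine hasSum_sum_of_ne_finset_zero fun k hk => ?_
    rw [Finset.mem_range, Nat.lt_succ_iff] at hk
    rw [if_neg hk, zero_mul, Complex.ofReal_zero]
  have h3 := hasSum_sum (s := range (n + 1)) fun j _ =>
    (hasSum_iteratedDeriv_aFun F H (α := fun k => ((PowerSeries.coeff k (aSeries g d) : ℝ) : ℂ))
      (by rw [coeff_zero_aSeries hg, Complex.ofReal_one]) (mul_ofReal_coeff_aSeries hg hgd) j
      (inv_card_mem_ball F)).mul_left (((-1) ^ j * oneSubCoeff (j - d 1) N : ℝ) : ℂ)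
  refine (h1.sub h3).congr_fun ?_
  intro k
  rw [taylorDefect, sub_mul, Finset.sum_mul, Complex.ofReal_sub, Complex.ofReal_sum]
  congr 1
  refine Finset.sum_congr rfl fun j _ => ?_
  push_cast
  ring

end

theorem summable_pow_mul_sqrt_two (M : ℕ) :
    Summable fun k : ℕ => ((k : ℝ) + 1) ^ M * (1 / √2) ^ (k + 1) := by
  have h : ‖1 / √2‖ < 1 := by
    have h2 : (1 : ℝ) < √2 := Real.lt_sqrt_of_sq_lt (by norm_num)
    rw [Real.norm_of_nonneg (by positivity), div_lt_one (by linarith)]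
    exact h2
  have h3 := summable_pow_mul_geometric_of_norm_lt_one M h
  rw [← summable_nat_add_iff 1] at h3
  refine h3.congr fun k => ?_
  rw [Nat.cast_add, Nat.cast_one]

/-- The expansion of `T(N)` with a remainder whose constant depends on `n` only. -/
theorem exists_norm_T_sub_mainTerm_le (n : ℕ) : ∃ C : ℝ, ∀ d : ℕ → ℝ, Admissible d →
    ∀ (F : Type*) [Field F] [Fintype F] (g : F[X] → ℝ), IsMultiplicative g →
      (∀ P : F[X], P.Monic → Irreducible P → ∀ k : ℕ, 1 ≤ k → g (P ^ k) = d k) →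
      ∀ N : ℕ, n + 1 ≤ N →
        ‖(T g N : ℂ) - (((-1) ^ N * Ring.choose (-d 1) N * (Fintype.card F : ℝ) ^ N : ℝ) : ℂ) *
          (aFun F d (Fintype.card F : ℂ)⁻¹ +
            ∑ k ∈ Icc 1 n, ((Ring.choose ((k : ℝ) - d 1) k
              / Ring.choose ((N : ℝ) + d 1 - 1) k : ℝ) : ℂ) *
              ((Fintype.card F : ℂ)⁻¹ ^ k / (k.factorial : ℂ)) *
              iteratedDeriv k (aFun F d) (Fintype.card F : ℂ)⁻¹)‖
          ≤ C * ((Fintype.card F : ℝ) ^ N / (N : ℝ) ^ (1 - d 1)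
              * (1 / (√(Fintype.card F) * N)) ^ (n + 1)) := by
  -- All constants are fixed before d and F are introduced, so the final constant depends on n only.
  obtain ⟨K, t, hK0, hK⟩ := exists_abs_coeff_aSeries_le
  obtain ⟨Z, hZ0, hZ⟩ := exists_abs_taylorDefect_le n
  set M := t + (2 * n + 3) with hM
  refine ⟨K * Z * √2 ^ (n + 2) * ∑' k : ℕ, ((k : ℝ) + 1) ^ M * (1 / √2) ^ (k + 1),
    fun d H F _ _ g hg hgd N hN => ?_⟩
  have hq2 : (2 : ℝ) ≤ Fintype.card F := by exact_mod_cast Fintype.one_lt_card (α := F)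
  set q : ℝ := (Fintype.card F : ℝ) with hq
  have hq0 : 0 < q := by linarith
  have hN0 : (0 : ℝ) < N := by
    have : 0 < N := by omega
    exact_mod_cast this
  have hs2 : (0 : ℝ) < √2 := by positivity
  have hs0 : 0 < √q := Real.sqrt_pos.2 hq0
  have hs : √2 ≤ √q := Real.sqrt_le_sqrt hq2
  have hρ : 1 / √q ≤ 1 / √2 := one_div_le_one_div_of_le hs2 hs
  set W := (N : ℝ) ^ (1 - d 1) with hW
  have hW0 : 0 < W := by positivity
  have hβ : ∀ k, |PowerSeries.coeff k (aSeries g d) * q⁻¹ ^ k| ≤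
      K * ((k : ℝ) + 1) ^ t * (1 / √q) ^ k := by
    intro k
    have h1 := hK d H F g hg hgd k
    rw [Nat.card_eq_fintype_card, ← hq] at h1
    rw [abs_mul, abs_of_pos (by positivity : 0 < q⁻¹ ^ k)]
    calc _ ≤ K * ((k : ℝ) + 1) ^ t * √q ^ k * q⁻¹ ^ k := by gcongr
      _ = K * ((k : ℝ) + 1) ^ t * (√q * q⁻¹) ^ k := by rw [mul_pow]; ring
      _ = _ := by
        congr 2
        rw [← div_eq_mul_inv, div_eq_div_iff hq0.ne' hs0.ne', Real.mul_self_sqrt hq0.le, one_mul]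
  have hbound : ∀ k, ‖((taylorDefect (d 1) n N k *
      (PowerSeries.coeff k (aSeries g d) * q⁻¹ ^ k) : ℝ) : ℂ)‖ ≤
        (K * Z * √2 ^ (n + 2) * (1 / (W * (N : ℝ) ^ (n + 1)) * (1 / √q) ^ (n + 1))) *
          (((k : ℝ) + 1) ^ M * (1 / √2) ^ (k + 1)) := by
    intro k
    rw [Complex.norm_real, Real.norm_eq_abs, abs_mul]
    rcases le_or_gt k n with hk | hk
    · rw [taylorDefect_of_le _ hk, abs_zero, zero_mul]
      positivity
    · obtain ⟨i, rfl⟩ := Nat.exists_eq_add_of_le (Nat.succ_le_of_lt hk)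
      have h2 := hZ (d 1) H.pos H.lt_one N (by omega) (n.succ + i)
      -- The factor (1/√q)^{n+1} is kept for the error term, and each remaining 1/√q is bounded by
      -- 1/√2. The power √2^{n+2} only adjusts the exponent to that of `summable_pow_mul_sqrt_two`.
      have h3 : (1 / √q) ^ (n.succ + i) ≤
          (1 / √q) ^ (n + 1) * (√2 ^ (n + 2) * (1 / √2) ^ (n.succ + i + 1)) := by
        have h4 : √2 ^ (n + 2) * (1 / √2) ^ (n.succ + i + 1) = (1 / √2) ^ i := by
          rw [show n.succ + i + 1 = (n + 2) + i by omega, pow_add (1 / √2) (n + 2) i,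
            ← mul_assoc, ← mul_pow,
            mul_one_div_cancel hs2.ne', one_pow, one_mul]
        rw [h4, pow_add]
        gcongr
      calc _ ≤ (Z * (((n.succ + i : ℕ) : ℝ) + 1) ^ (2 * n + 3) / (W * (N : ℝ) ^ (n + 1))) *
            (K * (((n.succ + i : ℕ) : ℝ) + 1) ^ t *
              ((1 / √q) ^ (n + 1) * (√2 ^ (n + 2) * (1 / √2) ^ (n.succ + i + 1)))) := by
            refine mul_le_mul h2 ((hβ _).trans ?_) (abs_nonneg _) (by positivity)
            gcongr
        _ = _ := by
          rw [hM, pow_add _ t]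
          ring
  have hsum := hasSum_taylorDefect (F := F) H hg hgd N n
  have hnorm := tsum_of_norm_bounded ((summable_pow_mul_sqrt_two M).hasSum.mul_left _) hbound
  rw [hsum.tsum_eq] at hnorm
  have hcast : (((-1) ^ N * Ring.choose (-d 1) N * q ^ N : ℝ) : ℂ) =
      (((-1) ^ N * Ring.choose (-d 1) N : ℝ) : ℂ) * ((q ^ N : ℝ) : ℂ) := by push_cast; ring
  rw [hcast, mainTerm_eq H.pos hN, T_eq_sum_aSeries g d N, Complex.ofReal_mul, ← mul_sub, norm_mul,
    Complex.norm_real, Real.norm_of_nonneg (by positivity)]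
  refine (mul_le_mul_of_nonneg_left hnorm (by positivity)).trans (le_of_eq ?_)
  have hpow : (1 / (√q * N)) ^ (n + 1) = (1 / √q) ^ (n + 1) * (1 / (N : ℝ) ^ (n + 1)) := by
    rw [← one_div_mul_one_div, mul_pow, one_div_pow (N : ℝ)]
  rw [← hq, hpow]
  ring

end FqMean

end

theorem propositionA (n : ℕ) :
    ∃ C : ℝ, ∀ d : ℕ → ℝ, 0 < d 1 → d 1 < 1 →
      (∀ k : ℕ, 1 ≤ k → d (k + 1) ≤ d k) →
      (∀ k : ℕ, 1 ≤ k → (k : ℝ) * d k ≤ ((k : ℝ) + 1) * d (k + 1)) →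
      -- the bounds for the coefficients of `log f`
      (∀ k : ℕ, 1 ≤ k → 0 < FqMean.aSeq d k ∧ FqMean.aSeq d k < 1 / (k : ℝ)) ∧
      ∀ (F : Type*) [Field F] [Fintype F],
        -- the product `a(x)` converges to a nonzero value, and is holomorphic, in `|x| < q^{-1/2}`
        (∀ x ∈ Metric.ball (0 : ℂ) (1 / Real.sqrt (Fintype.card F)),
          Multipliable (fun l : ℕ => FqMean.eulerFactor F d (l + 1) x) ∧
            FqMean.aFun F d x ≠ 0) ∧
        DifferentiableOn ℂ (FqMean.aFun F d)
          (Metric.ball (0 : ℂ) (1 / Real.sqrt (Fintype.card F))) ∧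
        ∀ g : F[X] → ℝ, FqMean.IsMultiplicative g →
          (∀ P : F[X], P.Monic → Irreducible P → ∀ k : ℕ, 1 ≤ k → g (P ^ k) = d k) →
          -- the expansion of `T(N)` in powers of `q`; note `h < N`, so `N - l` does not truncate
          (∀ N h : ℕ, 190 ≤ N → 1 ≤ h → (h : ℝ) ≤ (N : ℝ) / (36 * Real.log N) →
            (17 * h) ^ (12 * h + 9) ≤ Fintype.card F →
            |FqMean.T g N
                - ∑ l ∈ Finset.range h, FqMean.A d l N * (Fintype.card F : ℝ) ^ (N - l)|
              ≤ 3.1 * (d 1 * (Fintype.card (Nat.Partition h) : ℝ)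
                  * (Fintype.card F : ℝ) ^ (N - h) / (N : ℝ) ^ (1 - d 1)) ∧
            ∀ l : ℕ, l < h → |FqMean.A d l N|
              ≤ 3 * d 1 * (Fintype.card (Nat.Partition l) : ℝ) / (N : ℝ) ^ (1 - d 1)) ∧
          -- the expansion of `T(N)` with a remainder constant depending on `n` only
          (∀ N : ℕ, n + 1 ≤ N →
            ‖(FqMean.T g N : ℂ) -
                (((-1) ^ N * Ring.choose (-d 1) N * (Fintype.card F : ℝ) ^ N : ℝ) : ℂ) *
                  (FqMean.aFun F d (Fintype.card F : ℂ)⁻¹ +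
                    ∑ k ∈ Finset.Icc 1 n,
                      ((Ring.choose ((k : ℝ) - d 1) k
                        / Ring.choose ((N : ℝ) + d 1 - 1) k : ℝ) : ℂ) *
                      ((Fintype.card F : ℂ)⁻¹ ^ k / (k.factorial : ℂ)) *
                      iteratedDeriv k (FqMean.aFun F d) (Fintype.card F : ℂ)⁻¹)‖
              ≤ C * ((Fintype.card F : ℝ) ^ N / (N : ℝ) ^ (1 - d 1)
                  * (1 / (Real.sqrt (Fintype.card F) * N)) ^ (n + 1))) := by
  obtain ⟨C, hC⟩ := FqMean.exists_norm_T_sub_mainTerm_le n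
  refine ⟨C, fun d h0 h1 hanti hincr => ?_⟩
  have H : FqMean.Admissible d := ⟨h0, h1, hanti, hincr⟩
  refine ⟨fun k hk => FqMean.aSeq_pos_and_lt H hk, fun F _ _ => ⟨fun x hx => ?_,
    FqMean.differentiableOn_aFun F H, fun g hg hgd => ⟨fun N h hN hh hhN hq => ⟨?_, ?_⟩,
    fun N hN => hC d H F g hg hgd N hN⟩⟩⟩
  · refine ⟨(FqMean.hasProd_eulerFactor F H hx).multipliable, ?_⟩
    rw [FqMean.aFun_eq_cexp F H hx]
    exact Complex.exp_ne_zero _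
  · exact FqMean.abs_T_sub_sum_le H hg hgd hN hh (FqMean.le_of_le_div_log hN hhN) hq
  · intro l hl
    have h36 := FqMean.le_of_le_div_log hN hhN
    refine (FqMean.abs_A_le_of_le H hN (l := l) (by omega)).trans ?_
    rw [mul_assoc 3, mul_div_assoc 3]
    refine mul_le_mul_of_nonneg_right (by norm_num) ?_
    have := H.pos
    positivity
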